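/- **Setting.** Let $\Omega$ be a topological space, $n,m_I,m_E,m_C\in\mathbb N$, and let $f:\mathbb R^n\times\Omega\to\mathbb R$, $g:\mathbb R^n\times\Omega\to\mathbb R^{m_I}$, $h:\mathbb R^n\times\Omega\to\mathbb R^{m_E}$, $G,H:\mathbb R^n\times\Omega\to\mathbb R^{m_C}$ be continuous. Consider $$MPEC(\omega)\qquad \min_x f(x,\omega)\quad\text{s.t.}\quad g(x,\omega)\le 0,\ h(x,\omega)=0,\ G_i(x,\omega)\ge0,\ H_i(x,\omega)\ge0,\ G_i(x,\omega)H_i(x,\omega)=0\ (i=1,\dots,m_C).$$ Put $q:=(g,h,-(G_1,H_1),\dots,-(G_{m_C},H_{m_C}))$, $Q_{EC}:=\{(a,b)\in\mathbb R^2_-: ab=0\}$, $P:=\mathbb R^{m_I}_-\times\{0\}^{m_E}\times Q_{EC}^{m_C}$, $\mathcal F(\omega):=\{x: q(x,\omega)\in P\}$ and $M_\omega(x):=q(x,\omega)-P$; all norms are Euclidean (operator norms for linear maps). Let $\bar\omega\in\Omega$, $\bar x\in\mathcal F(\bar\omega)$, and assume that there are an open neighborhood $U_0$ of $\bar x$ and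 a neighborhood $W_0$ of $\bar\omega$ such that $f(\cdot,\omega)$ and $q(\cdot,\omega)$ are $C^2$ on $U_0$ for every $\omega\in W_0$, and that $\nabla_xf,\nabla_xq,\nabla_x^2f,\nabla_x^2q$ are continuous at $(\bar x,\bar\omega)$. For a closed set $\Gamma$ and $x\in\Gamma$ let $T(x;\Gamma):=\{u:\exists t_k\downarrow0,\ u_k\to u,\ x+t_ku_k\in\Gamma\}$ be the contingent cone; for an arbitrary set $\Gamma$ and $x\in\Gamma$ let $\hat N(x;\Gamma):=\{\xi:\limsup_{x'\to x,\,x'\in\Gamma}\xi^T(x'-x)/\|x'-x\|\le0\}$ be the regular normal cone and $N(x;\Gamma):=\{\lim\xi_k:\ \xi_k\in\hat N(x_k;\Gamma),\ x_k\to x,\ x_k\in\Gamma\}$ the limiting normal cone; all these are empty if $x\notin\Gamma$. The sets of B- and M-stationary points are $$S(\omega):=\{x:0\in\nabla_xf(x,\omega)+\hat N(x;\mathcal F(\omega))\},\qquad S_M(\omega):=\{x:0\in\nabla_xf(x,\omega)+\nabla_xq(x,\omega)^TN(q(x,\omega);P)\}.$$ For $l\in\{1,2\}$ put $e_l(\omega):=\|\nabla_xq(\bar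 x,\omega)-\nabla_xq(\bar x,\bar\omega)\|+\|q(\bar x,\omega)-q(\bar x,\bar\omega)\|^{1/l}$ and $\tau_l(\omega):=\|\nabla_xf(\bar x,\omega)-\nabla_xf(\bar x,\bar\omega)\|+e_l(\omega)$. Property $R_l$ means: there are neighborhoods $U$ of $\bar x$, $W$ of $\bar\omega$ and $\kappa,\gamma>0$ such that for all $\omega\in W$ and all $x\in\mathcal F(\omega)\cap U$ with $\|x-\bar x\|>\gamma e_l(\omega)$ the multifunction $M_\omega$ is metrically regular with modulus $\kappa$ around $(x,0)$, i.e. $\operatorname{dist}(x',M_\omega^{-1}(y'))\le\kappa\operatorname{dist}(y',M_\omega(x'))$ for all $(x',y')$ near $(x,0)$ (with $\operatorname{dist}(\cdot,\emptyset)=\infty$). Let $T^{\rm lin}:=\{u:\nabla_xq(\bar x,\bar\omega)u\in T(q(\bar x,\bar\omega);P)\}$. With all functions and derivatives evaluated at $(\bar x,\bar\omega)$, let $\bar I_g:=\{i:g_i=0\}$, $\bar I^{+0}:=\{i:G_i>0=H_i\}$, $\bar I^{0+}:=\{i:G_i=0<H_i\}$, $\bar I^{00}:=\{i:G_i=0=H_i\}$,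 and for $u\in T^{\rm lin}$ let $I_g(u):=\{i\in\bar I_g:\nabla_x g_iu=0\}$, $I^{+0}(u):=\{i\in\bar I^{00}:\nabla_x G_iu>0=\nabla_x H_iu\}$, $I^{0+}(u):=\{i\in\bar I^{00}:\nabla_x G_iu=0<\nabla_x H_iu\}$, $I^{00}(u):=\{i\in\bar I^{00}:\nabla_x G_iu=0=\nabla_x H_iu\}$. For $\lambda_0\in\mathbb R$ and $\lambda=(\lambda^g,\lambda^h,\lambda^G,\lambda^H)\in\mathbb R^{m_I}\times\mathbb R^{m_E}\times\mathbb R^{m_C}\times\mathbb R^{m_C}$ let $$\mathcal L^{\lambda_0}(x,\lambda,\omega):=\lambda_0f(x,\omega)+\sum_i\lambda^g_ig_i(x,\omega)+\sum_i\lambda^h_ih_i(x,\omega)-\sum_i\big(\lambda^G_iG_i(x,\omega)+\lambda^H_iH_i(x,\omega)\big).$$ Consider the following conditions on $u,\nu\in\mathbb R^n$ and multipliers $\lambda,\mu$. (A) *Conditions on $\lambda$:* $\lambda^g_i\ge0$ for $i\in I_g(u)$ and $\lambda^g_i=0$ for $i\notin I_g(u)$; $\lambda^H_i=0$ for $i\in\bar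 I^{0+}\cup I^{0+}(u)$; $\lambda^G_i=0$ for $i\in\bar I^{+0}\cup I^{+0}(u)$; and for $i\in I^{00}(u)$ either $\lambda^G_i>0,\lambda^H_i>0$ or $\lambda^G_i\lambda^H_i=0$. (B) *Conditions on $\mu$:* $\mu^g_i\ge0$ for $i\in I_g(u)$ with $\lambda^g_i=0$, and $\mu^g_i=0$ for $i\notin I_g(u)$; $\mu^H_i=0$ for $i\in\bar I^{0+}\cup I^{0+}(u)$; $\mu^G_i=0$ for $i\in\bar I^{+0}\cup I^{+0}(u)$; and for $i\in I^{00}(u)$: if $\lambda^G_i=\lambda^H_i=0$, then either $\mu^G_i>0,\mu^H_i>0$ or $\mu^G_i\mu^H_i=0$; if $\lambda^G_i=0<\lambda^H_i$, then $\mu^G_i\ge0$; if $\lambda^G_i=0>\lambda^H_i$, then $\mu^G_i=0$; if $\lambda^H_i=0<\lambda^G_i$, then $\mu^H_i\ge0$; if $\lambda^H_i=0>\lambda^G_i$, then $\mu^H_i=0$. (C) $\nabla_x\mathcal L^1(\bar x,\lambda,\bar\omega)=0$ and $\nabla_x^2\mathcal L^1(\bar x,\lambda,\bar\omega)u+\nabla_x\mathcal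 L^0(\bar x,\mu,\bar\omega)=0$. (D) Writing $\theta_\varphi:=\nabla_x\varphi(\bar x,\bar\omega)\nu+u^T\nabla_x^2\varphi(\bar x,\bar\omega)u$: $\theta_{g_i}\le0$ for $i\in\bar I_g$; $\theta_{h_i}=0$ for all $i$; $\theta_{G_i}=0$ for $i\in\bar I^{0+}\cup I^{0+}(u)$; $\theta_{H_i}=0$ for $i\in\bar I^{+0}\cup I^{+0}(u)$; $-(\theta_{G_i},\theta_{H_i})\in T((0,0);Q_{EC})$ for $i\in I^{00}(u)$; and $u^T\nabla_x^2\mathcal L^0(\bar x,\lambda,\bar\omega)u=\nabla_xf(\bar x,\bar\omega)\nu$. **Statement.** 1. If property $R_1$ holds and there are no $0\ne u\in T^{\rm lin}$, $\lambda$, $\mu$ satisfying (A), (B), (C), then there are neighborhoods $U$ of $\bar x$, $W$ of $\bar\omega$ and a constant $L>0$ such that $\|x-\bar x\|\le L\,\tau_1(\omega)$ for all $\omega\in W$ and all $x\in(S(\omega)\cup S_M(\omega))\cap U$. 2. If property $R_2$ holds and there are no $0\ne u\in T^{\rm lin}$, $\lambda$, $\mu$, $\nu$ satisfying (A), (B),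 (C), (D), then there are neighborhoods $U$ of $\bar x$, $W$ of $\bar\omega$ and a constant $L>0$ such that $\|x-\bar x\|\le L\,\tau_2(\omega)$ for all $\omega\in W$ and all $x\in(S(\omega)\cup S_M(\omega))\cap U$. -/

import Mathlib

open Filter Topology

noncomputable section

namespace ParamMPEC

section Variational

/-- The contingent (Bouligand tangent) cone `T(x; Γ)`, empty if `x ∉ Γ`. -/
def contingentCone {E : Type*} [NormedAddCommGroup E] [NormedSpace ℝ E]
    (Γ : Set E) (x : E) : Set E :=
  {u | x ∈ Γ ∧ ∃ (t : ℕ → ℝ) (v : ℕ → E), (∀ k, 0 < t k) ∧ Tendsto t atTop (𝓝 0) ∧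
    Tendsto v atTop (𝓝 u) ∧ ∀ k, x + t k • v k ∈ Γ}

/-- The regular (Fréchet) normal cone, empty if `x ∉ Γ`. The condition
`limsup ⟪ξ, y - x⟫ / ‖y - x‖ ≤ 0` as `y → x` within `Γ` is written in its `ε`-form. -/
def regularNormalCone {E : Type*} [NormedAddCommGroup E] [InnerProductSpace ℝ E]
    (Γ : Set E) (x : E) : Set E :=
  {ξ | x ∈ Γ ∧ ∀ ε > (0 : ℝ), ∀ᶠ y in 𝓝[Γ] x, inner ℝ ξ (y - x) ≤ ε * ‖y - x‖}

/-- The limiting (Mordukhovich) normal cone `N(x; Γ)`, empty if `x ∉ Γ`. -/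
def limitingNormalCone {E : Type*} [NormedAddCommGroup E] [InnerProductSpace ℝ E]
    (Γ : Set E) (x : E) : Set E :=
  {ξ | x ∈ Γ ∧ ∃ (y : ℕ → E) (η : ℕ → E), Tendsto y atTop (𝓝 x) ∧ Tendsto η atTop (𝓝 ξ) ∧
    ∀ k, y k ∈ Γ ∧ η k ∈ regularNormalCone Γ (y k)}

/-- The multifunction `M` is metrically regular with modulus `κ` around the point `(x, y)` of its
graph. The distance to the empty set is `∞`. -/
def MetricallyRegularAround {E F : Type*} [NormedAddCommGroup E] [NormedAddCommGroup F]
    (M : E → Set F) (κ : ℝ) (x : E) (y : F) : Prop :=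
  y ∈ M x ∧ ∃ U ∈ 𝓝 x, ∃ V ∈ 𝓝 y, ∀ x' ∈ U, ∀ y' ∈ V,
    Metric.infEDist x' {z | y' ∈ M z} ≤ ENNReal.ofReal κ * Metric.infEDist y' (M x')

end Variational

section Parametric

variable {E F Ω : Type*} [NormedAddCommGroup E] [InnerProductSpace ℝ E] [CompleteSpace E]
  [NormedAddCommGroup F] [InnerProductSpace ℝ F] [CompleteSpace F]

/-- The partial gradient `∇ₓ φ(x, ω)` of a real function. -/
def gradX (φ : E → Ω → ℝ) (x : E) (ω : Ω) : E := gradient (fun y => φ y ω) x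

/-- The partial Hessian `∇ₓ² φ(x, ω)` of a real function, as a linear operator. -/
def hessX (φ : E → Ω → ℝ) (x : E) (ω : Ω) : E →L[ℝ] E := fderiv ℝ (fun y => gradX φ y ω) x

/-- The partial derivative (Jacobian) `∇ₓ q(x, ω)`. -/
def jacX (q : E → Ω → F) (x : E) (ω : Ω) : E →L[ℝ] F := fderiv ℝ (fun y => q y ω) x

/-- The second partial derivative `∇ₓ² q(x, ω)`. -/
def jac2X (q : E → Ω → F) (x : E) (ω : Ω) : E →L[ℝ] E →L[ℝ] F :=
  fderiv ℝ (fun y => jacX q y ω) x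

/-- The feasible set `{x | q(x, ω) ∈ P}`. -/
def feasibleSet (q : E → Ω → F) (P : Set F) (ω : Ω) : Set E := {x | q x ω ∈ P}

/-- The constraint multifunction `x ↦ q(x, ω) - P`. -/
def constraintMap (q : E → Ω → F) (P : Set F) (ω : Ω) (x : E) : Set F :=
  {z | ∃ p ∈ P, z = q x ω - p}

/-- The linearized cone `{u | ∇ₓ q(x, ω) u ∈ T(q(x, ω); P)}`. -/
def linearizedCone (q : E → Ω → F) (P : Set F) (ω : Ω) (x : E) : Set E :=
  {u | jacX q x ω u ∈ contingentCone P (q x ω)}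

/-- The B-stationary points, `0 ∈ ∇ₓ f(x, ω) + N̂(x; {x | q(x, ω) ∈ P})`. -/
def BStationary (f : E → Ω → ℝ) (q : E → Ω → F) (P : Set F) (ω : Ω) : Set E :=
  {x | ∃ ξ ∈ regularNormalCone (feasibleSet q P ω) x, gradX f x ω + ξ = 0}

/-- The M-stationary points, `0 ∈ ∇ₓ f(x, ω) + ∇ₓ q(x, ω)ᵀ N(q(x, ω); P)`. -/
def MStationary (f : E → Ω → ℝ) (q : E → Ω → F) (P : Set F) (ω : Ω) : Set E :=
  {x | ∃ y ∈ limitingNormalCone P (q x ω),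
    gradX f x ω + ContinuousLinearMap.adjoint (jacX q x ω) y = 0}

/-- `e_l(ω) = ‖∇ₓ q(x̄, ω) - ∇ₓ q(x̄, ω̄)‖ + ‖q(x̄, ω) - q(x̄, ω̄)‖ ^ (1 / l)`. -/
def eFun (q : E → Ω → F) (xb : E) (ob : Ω) (l : ℕ) (ω : Ω) : ℝ :=
  ‖jacX q xb ω - jacX q xb ob‖ + ‖q xb ω - q xb ob‖ ^ (1 / (l : ℝ))

/-- `τ_l(ω) = ‖∇ₓ f(x̄, ω) - ∇ₓ f(x̄, ω̄)‖ + e_l(ω)`. -/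
def tauFun (f : E → Ω → ℝ) (q : E → Ω → F) (xb : E) (ob : Ω) (l : ℕ) (ω : Ω) : ℝ :=
  ‖gradX f xb ω - gradX f xb ob‖ + eFun q xb ob l ω

/-- Property `R_l`: uniform metric regularity around all feasible points `x` near `x̄` with
`‖x - x̄‖ > γ e_l(ω)`. -/
def PropertyR [TopologicalSpace Ω] (q : E → Ω → F) (P : Set F) (xb : E) (ob : Ω) (l : ℕ) : Prop :=
  ∃ U ∈ 𝓝 xb, ∃ W ∈ 𝓝 ob, ∃ κ > (0 : ℝ), ∃ γ > (0 : ℝ),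
    ∀ ω ∈ W, ∀ x ∈ feasibleSet q P ω ∩ U, γ * eFun q xb ob l ω < ‖x - xb‖ →
      MetricallyRegularAround (constraintMap q P ω) κ x 0

/-- The standing assumption on the data: continuity, and partial smoothness of second order in `x`
near the reference point. -/
structure BasicAssumption [TopologicalSpace Ω] (f : E → Ω → ℝ) (q : E → Ω → F)
    (xb : E) (ob : Ω) : Prop where
  continuous_f : Continuous fun p : E × Ω => f p.1 p.2
  continuous_q : Continuous fun p : E × Ω => q p.1 p.2
  contDiff_near : ∃ U : Set E, IsOpen U ∧ xb ∈ U ∧ ∃ W ∈ 𝓝 ob, ∀ ω ∈ W,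
    ContDiffOn ℝ 2 (fun x => f x ω) U ∧ ContDiffOn ℝ 2 (fun x => q x ω) U
  continuousAt_gradX : ContinuousAt (fun p : E × Ω => gradX f p.1 p.2) (xb, ob)
  continuousAt_jacX : ContinuousAt (fun p : E × Ω => jacX q p.1 p.2) (xb, ob)
  continuousAt_hessX : ContinuousAt (fun p : E × Ω => hessX f p.1 p.2) (xb, ob)
  continuousAt_jac2X : ContinuousAt (fun p : E × Ω => jac2X q p.1 p.2) (xb, ob)

end Parametric

/-- The set `Q_EC = {(a, b) | a ≤ 0, b ≤ 0, a b = 0}`. -/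
def QEC : Set (ℝ × ℝ) := {a | a.1 ≤ 0 ∧ a.2 ≤ 0 ∧ a.1 * a.2 = 0}

/-- The data of a parametric MPEC: minimize `f(x, ω)` subject to `g_i(x, ω) ≤ 0`, `h_i(x, ω) = 0`,
`G_i(x, ω) ≥ 0`, `H_i(x, ω) ≥ 0`, `G_i(x, ω) H_i(x, ω) = 0`. -/
structure MPEC (n mI mE mC : ℕ) (Ω : Type*) where
  f : EuclideanSpace ℝ (Fin n) → Ω → ℝ
  g : Fin mI → EuclideanSpace ℝ (Fin n) → Ω → ℝ
  h : Fin mE → EuclideanSpace ℝ (Fin n) → Ω → ℝ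
  G : Fin mC → EuclideanSpace ℝ (Fin n) → Ω → ℝ
  H : Fin mC → EuclideanSpace ℝ (Fin n) → Ω → ℝ

/-- The space `ℝ^{mI} × ℝ^{mE} × (ℝ²)^{mC}` with its Euclidean norm. -/
abbrev CSpace (mI mE mC : ℕ) : Type :=
  EuclideanSpace ℝ (Fin mI ⊕ Fin mE ⊕ (Fin mC × Fin 2))

/-- The set `P = ℝ₋^{mI} × {0}^{mE} × Q_EC^{mC}`. -/
def mpecSet (mI mE mC : ℕ) : Set (CSpace mI mE mC) :=
  {y | (∀ i, y (Sum.inl i) ≤ 0) ∧ (∀ i, y (Sum.inr (Sum.inl i)) = 0) ∧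
    ∀ i, (y (Sum.inr (Sum.inr (i, 0))), y (Sum.inr (Sum.inr (i, 1)))) ∈ QEC}

/-- Multipliers `(λ^g, λ^h, λ^G, λ^H)`. -/
structure Multiplier (mI mE mC : ℕ) where
  g : Fin mI → ℝ
  h : Fin mE → ℝ
  G : Fin mC → ℝ
  H : Fin mC → ℝ

namespace MPEC

variable {n mI mE mC : ℕ} {Ω : Type*} (D : MPEC n mI mE mC Ω)
  (xb : EuclideanSpace ℝ (Fin n)) (ob : Ω) (u : EuclideanSpace ℝ (Fin n))

/-- The constraint mapping `q = (g, h, -(G_1, H_1), …, -(G_{mC}, H_{mC}))`. -/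
def q (x : EuclideanSpace ℝ (Fin n)) (ω : Ω) : CSpace mI mE mC :=
  WithLp.toLp 2 (Sum.elim (fun i => D.g i x ω) (Sum.elim (fun i => D.h i x ω)
    (fun j => -(if j.2 = 0 then D.G j.1 x ω else D.H j.1 x ω))))

/-- Membership in the feasible set, written out. -/
theorem mem_feasibleSet_iff (x : EuclideanSpace ℝ (Fin n)) (ω : Ω) :
    x ∈ feasibleSet D.q (mpecSet mI mE mC) ω ↔
      (∀ i, D.g i x ω ≤ 0) ∧ (∀ i, D.h i x ω = 0) ∧
        ∀ i, 0 ≤ D.G i x ω ∧ 0 ≤ D.H i x ω ∧ D.G i x ω * D.H i x ω = 0 := by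
  simp [feasibleSet, mpecSet, QEC, q]

/-- The index set `Ī_g`. -/
def idxg : Set (Fin mI) := {i | D.g i xb ob = 0}

/-- The index set `Ī^{+0}`. -/
def idxPZ : Set (Fin mC) := {i | 0 < D.G i xb ob ∧ D.H i xb ob = 0}

/-- The index set `Ī^{0+}`. -/
def idxZP : Set (Fin mC) := {i | D.G i xb ob = 0 ∧ 0 < D.H i xb ob}

/-- The index set `Ī^{00}`. -/
def idxZZ : Set (Fin mC) := {i | D.G i xb ob = 0 ∧ D.H i xb ob = 0}

/-- The index set `I_g(u)`. -/
def idxgDir : Set (Fin mI) := {i | i ∈ D.idxg xb ob ∧ inner ℝ (gradX (D.g i) xb ob) u = 0}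

/-- The index set `I^{+0}(u)`. -/
def idxPZDir : Set (Fin mC) := {i | i ∈ D.idxZZ xb ob ∧
  0 < inner ℝ (gradX (D.G i) xb ob) u ∧ inner ℝ (gradX (D.H i) xb ob) u = 0}

/-- The index set `I^{0+}(u)`. -/
def idxZPDir : Set (Fin mC) := {i | i ∈ D.idxZZ xb ob ∧
  inner ℝ (gradX (D.G i) xb ob) u = 0 ∧ 0 < inner ℝ (gradX (D.H i) xb ob) u}

/-- The index set `I^{00}(u)`. -/
def idxZZDir : Set (Fin mC) := {i | i ∈ D.idxZZ xb ob ∧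
  inner ℝ (gradX (D.G i) xb ob) u = 0 ∧ inner ℝ (gradX (D.H i) xb ob) u = 0}

/-- The extended Lagrangian
`l₀ f + ∑ λ^g_i g_i + ∑ λ^h_i h_i - ∑ (λ^G_i G_i + λ^H_i H_i)`. -/
def lagrangian (l₀ : ℝ) (lam : Multiplier mI mE mC) (x : EuclideanSpace ℝ (Fin n)) (ω : Ω) : ℝ :=
  l₀ * D.f x ω + ∑ i, lam.g i * D.g i x ω + ∑ i, lam.h i * D.h i x ω
    - ∑ i, (lam.G i * D.G i x ω + lam.H i * D.H i x ω)

/-- The sign conditions on the multiplier `λ` in direction `u`. -/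
structure DirMultiplier (lam : Multiplier mI mE mC) : Prop where
  g_nonneg : ∀ i ∈ D.idxgDir xb ob u, 0 ≤ lam.g i
  g_zero : ∀ i ∉ D.idxgDir xb ob u, lam.g i = 0
  H_zero : ∀ i ∈ D.idxZP xb ob ∪ D.idxZPDir xb ob u, lam.H i = 0
  G_zero : ∀ i ∈ D.idxPZ xb ob ∪ D.idxPZDir xb ob u, lam.G i = 0
  GH : ∀ i ∈ D.idxZZDir xb ob u, (0 < lam.G i ∧ 0 < lam.H i) ∨ lam.G i * lam.H i = 0

/-- The sign conditions on the multiplier `μ`, given the direction `u` and the multiplier `λ`. -/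
structure TangentMultiplier (lam mu : Multiplier mI mE mC) : Prop where
  g_nonneg : ∀ i ∈ D.idxgDir xb ob u, lam.g i = 0 → 0 ≤ mu.g i
  g_zero : ∀ i ∉ D.idxgDir xb ob u, mu.g i = 0
  H_zero : ∀ i ∈ D.idxZP xb ob ∪ D.idxZPDir xb ob u, mu.H i = 0
  G_zero : ∀ i ∈ D.idxPZ xb ob ∪ D.idxPZDir xb ob u, mu.G i = 0
  GH : ∀ i ∈ D.idxZZDir xb ob u, lam.G i = 0 → lam.H i = 0 →
    (0 < mu.G i ∧ 0 < mu.H i) ∨ mu.G i * mu.H i = 0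
  G_nonneg_of_pos : ∀ i ∈ D.idxZZDir xb ob u, lam.G i = 0 → 0 < lam.H i → 0 ≤ mu.G i
  G_zero_of_neg : ∀ i ∈ D.idxZZDir xb ob u, lam.G i = 0 → lam.H i < 0 → mu.G i = 0
  H_nonneg_of_pos : ∀ i ∈ D.idxZZDir xb ob u, lam.H i = 0 → 0 < lam.G i → 0 ≤ mu.H i
  H_zero_of_neg : ∀ i ∈ D.idxZZDir xb ob u, lam.H i = 0 → lam.G i < 0 → mu.H i = 0

/-- The conditions on `(u, λ, μ)`: the sign conditions on `λ` and `μ`, `∇ₓ 𝓛¹(x̄, λ, ω̄) = 0` and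
`∇ₓ² 𝓛¹(x̄, λ, ω̄) u + ∇ₓ 𝓛⁰(x̄, μ, ω̄) = 0`. -/
structure LipschitzSystem (lam mu : Multiplier mI mE mC) : Prop where
  dirMultiplier : D.DirMultiplier xb ob u lam
  tangentMultiplier : D.TangentMultiplier xb ob u lam mu
  grad_zero : gradX (D.lagrangian 1 lam) xb ob = 0
  second_order : hessX (D.lagrangian 1 lam) xb ob u + gradX (D.lagrangian 0 mu) xb ob = 0

/-- `∇ₓ φ(x̄, ω̄) ν + uᵀ ∇ₓ² φ(x̄, ω̄) u`. -/
def secondOrderTerm (φ : EuclideanSpace ℝ (Fin n) → Ω → ℝ) (ν : EuclideanSpace ℝ (Fin n)) : ℝ :=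
  inner ℝ (gradX φ xb ob) ν + inner ℝ u (hessX φ xb ob u)

/-- The additional conditions on `ν` in the Hölder case. -/
structure HoelderSystem (lam : Multiplier mI mE mC) (ν : EuclideanSpace ℝ (Fin n)) : Prop where
  g_le : ∀ i ∈ D.idxg xb ob, secondOrderTerm xb ob u (D.g i) ν ≤ 0
  h_eq : ∀ i, secondOrderTerm xb ob u (D.h i) ν = 0
  G_eq : ∀ i ∈ D.idxZP xb ob ∪ D.idxZPDir xb ob u, secondOrderTerm xb ob u (D.G i) ν = 0
  H_eq : ∀ i ∈ D.idxPZ xb ob ∪ D.idxPZDir xb ob u, secondOrderTerm xb ob u (D.H i) ν = 0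
  GH_mem : ∀ i ∈ D.idxZZDir xb ob u,
    -(secondOrderTerm xb ob u (D.G i) ν, secondOrderTerm xb ob u (D.H i) ν) ∈
      contingentCone QEC (0, 0)
  second_order : inner ℝ u (hessX (D.lagrangian 0 lam) xb ob u) = inner ℝ (gradX D.f xb ob) ν

end MPEC

end ParamMPEC

end

/-!
The theorem is proved by contradiction, and all limits are taken along one ultrafilter.

If the stationary points `x` near `x̄` are not bounded by `L τ(ω)`, there is an ultrafilter along
which `(x, ω)` tends to `(x̄, ω̄)` while `τ(ω)` is of smaller order than `t = ‖x - x̄‖`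
(`exists_ultrafilter_of_not_subset_closedBall`). By compactness `(x - x̄) / t` converges to a unit
vector `u`. As `e_l ≤ τ_l`, the constraint map is eventually metrically regular around `(x, 0)` with
a fixed modulus. This bounds the normals to `P` near `q(x, ω)` by their images under `∇q(x, ω)ᵀ`
(`MetricallyRegularAround.eventually_norm_le`), and a penalty argument then turns B-stationarity into
approximate M-stationarity (`exists_limitingNormal_of_mem_regularNormalCone_preimage`). So there are
bounded multipliers `λ_x`, normal to `P` at `q(x, ω)`, whose stationarity residual is at most `t²`;
they converge to some `λ`.

Subtracting the stationarity conditions at `(x, ω)` and at `(x̄, ω̄)` and dividing by `t` shows that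
`∇q(x̄, ω̄)ᵀ ((λ_x - λ) / t)` converges to `-∇²𝓛¹(x̄, λ, ω̄) u`. The quotients `(λ_x - λ) / t` may be
unbounded, but each of their coordinates has an eventually constant sign pattern along the
ultrafilter, and a linear image of a cone given by coordinate signs is closed
(`exists_preimage_of_tendsto_of_signs`). Hence the limit is `∇q(x̄, ω̄)ᵀ μ` for a `μ` with the
required signs (`exists_tangent_multiplier`). For `l = 2` the deviation of the data at `x̄` is of
smaller order than `t²`, and the same closedness, applied to the second-order expansion of
`q(x, ω) ∈ P`, gives `ν` (`exists_second_order_direction`). The complementarity between `λ_x` and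
`q(x, ω)` gives the last equation of the Hölder system.
-/

noncomputable section

namespace ParamMPEC

/-! ### Finitely generated cones -/

/-- A finitely generated convex cone is closed. If the generators are linearly independent, it is
the image of an orthant under a closed embedding; otherwise Carathéodory's argument writes it as
the union of the cones with one generator removed. -/
theorem isClosed_conicalCombinations {ι F : Type*} [NormedAddCommGroup F] [NormedSpace ℝ F]
    (v : ι → F) (s : Finset ι) :
    IsClosed {b : F | ∃ c : ι → ℝ, (∀ i, 0 ≤ c i) ∧ ∑ i ∈ s, c i • v i = b} := by
  classical
  induction s using Finset.strongInduction with
  | H s ih =>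
  by_cases hli : LinearIndepOn ℝ v (s : Set ι)
  · have hinj : Function.Injective (Fintype.linearCombination ℝ (fun i : s => v i)) :=
      linearIndependent_iff_injective_fintypeLinearCombination.1 hli
    have hemb := LinearMap.isClosedEmbedding_of_injective (LinearMap.ker_eq_bot.2 hinj)
    have hcl : IsClosed {c : s → ℝ | ∀ i, 0 ≤ c i} := by
      simp only [Set.ofPred_forall]
      exact isClosed_iInter fun i => isClosed_le continuous_const (continuous_apply i)
    convert hemb.isClosedMap _ hcl using 1
    ext b
    simp only [Set.mem_ofPred_eq, Set.mem_image, Fintype.linearCombination_apply]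
    constructor
    · rintro ⟨c, hc, rfl⟩
      exact ⟨fun i => c i, fun i => hc i, Finset.sum_coe_sort s (fun i => c i • v i)⟩
    · rintro ⟨c, hc, rfl⟩
      refine ⟨fun i => if h : i ∈ s then c ⟨i, h⟩ else 0, fun i => ?_, ?_⟩
      · dsimp only
        split_ifs
        exacts [hc _, le_rfl]
      · rw [← Finset.sum_coe_sort s]
        simp
  · obtain ⟨d, hd, j, hj⟩ : ∃ d : ι → ℝ, ∑ i ∈ s, d i • v i = 0 ∧ ∃ j ∈ s, 0 < d j := by
      rw [linearIndepOn_finset_iff] at hli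
      push Not at hli
      obtain ⟨d, hd, j, hj, hne⟩ := hli
      rcases lt_or_gt_of_ne hne with h | h
      · exact ⟨fun i => -d i, by simp [hd], j, hj, by simpa using h⟩
      · exact ⟨d, hd, j, hj, h⟩
    have hunion : {b : F | ∃ c : ι → ℝ, (∀ i, 0 ≤ c i) ∧ ∑ i ∈ s, c i • v i = b} =
        ⋃ k ∈ s, {b : F | ∃ c : ι → ℝ, (∀ i, 0 ≤ c i) ∧ ∑ i ∈ s.erase k, c i • v i = b} := by
      ext b
      simp only [Set.mem_ofPred_eq, Set.mem_iUnion]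
      constructor
      · rintro ⟨c, hc, rfl⟩
        -- subtract the largest multiple of the relation `d` that keeps the coefficients nonnegative
        obtain ⟨k, hk, hmin⟩ := Finset.exists_min_image (s.filter fun i => 0 < d i)
          (fun i => c i / d i) ⟨j, by simpa using hj⟩
        rw [Finset.mem_filter] at hk
        have hr : 0 ≤ c k / d k := div_nonneg (hc k) hk.2.le
        have hnn : ∀ i ∈ s, 0 ≤ c i - c k / d k * d i := fun i hi => by
          by_cases hdi : 0 < d i
          · have := hmin i (by simp [hi, hdi])
            rw [le_div_iff₀ hdi] at this
            linarith
          · have := hc i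
            nlinarith
        refine ⟨k, hk.1, fun i => max 0 (c i - c k / d k * d i), fun i => le_max_left _ _, ?_⟩
        have h1 : ∑ i ∈ s, (c i - c k / d k * d i) • v i = ∑ i ∈ s, c i • v i := by
          simp_rw [sub_smul, Finset.sum_sub_distrib, mul_smul, ← Finset.smul_sum, hd]
          simp
        rw [← h1, ← Finset.add_sum_erase s _ hk.1, div_mul_cancel₀ _ hk.2.ne']
        simp only [sub_self, zero_smul, zero_add]
        refine Finset.sum_congr rfl fun i hi => ?_
        rw [max_eq_right (hnn i (Finset.mem_of_mem_erase hi))]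
      · rintro ⟨k, hk, c, hc, rfl⟩
        refine ⟨Function.update c k 0, fun i => ?_, ?_⟩
        · by_cases hik : i = k
          · simp [hik]
          · simpa [hik] using hc i
        · rw [← Finset.add_sum_erase s _ hk]
          simp only [Function.update_self, zero_smul, zero_add]
          refine Finset.sum_congr rfl fun i hi => ?_
          rw [Function.update_of_ne (Finset.ne_of_mem_erase hi)]
    rw [hunion]
    exact isClosed_biUnion_finset fun k hk => ih _ (Finset.erase_ssubset hk)

/-- The image of a cone given by sign conditions on the coordinates is closed: if `A (c k)`
converges, its limit is attained at a point that inherits all sign conditions which eventually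
hold for `c k`. The points `c k` themselves may be unbounded. -/
theorem exists_preimage_of_tendsto_of_signs {α ι F : Type*} [Finite ι]
    [NormedAddCommGroup F] [NormedSpace ℝ F] {l : Filter α} [l.NeBot] (A : (ι → ℝ) →ₗ[ℝ] F)
    {c : α → ι → ℝ} {b : F} (h : Tendsto (fun k => A (c k)) l (𝓝 b)) :
    ∃ c₀ : ι → ℝ, A c₀ = b ∧ (∀ i, (∀ᶠ k in l, 0 ≤ c k i) → 0 ≤ c₀ i) ∧
      (∀ i, (∀ᶠ k in l, c k i ≤ 0) → c₀ i ≤ 0) := by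
  classical
  have := Fintype.ofFinite ι
  -- generators `±A eᵢ`, the sign being dropped when the coordinate must not have it
  let p : ι → Prop := fun i => ∀ᶠ k in l, c k i ≤ 0
  let m : ι → Prop := fun i => ∀ᶠ k in l, 0 ≤ c k i
  let v : ι ⊕ ι → F := Sum.elim (fun i => if p i then 0 else A (Pi.single i 1))
    (fun i => if m i then 0 else -A (Pi.single i 1))
  have hA : ∀ z : ι → ℝ, A z = ∑ i, z i • A (Pi.single i 1) := fun z => by
    conv_lhs => rw [← Finset.univ_sum_single z, map_sum]
    refine Finset.sum_congr rfl fun i _ => ?_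
    rw [← map_smul, ← Pi.single_smul, smul_eq_mul, mul_one]
  have hev : ∀ᶠ k in l, ∀ i, (p i → c k i ≤ 0) ∧ (m i → 0 ≤ c k i) := by
    rw [eventually_all]
    intro i
    refine Eventually.and ?_ ?_
    · by_cases hp : p i
      · exact hp.mono fun k hk _ => hk
      · exact Eventually.of_forall fun k h => absurd h hp
    · by_cases hm : m i
      · exact hm.mono fun k hk _ => hk
      · exact Eventually.of_forall fun k h => absurd h hm
  obtain ⟨d, hd, hdb⟩ := (isClosed_conicalCombinations v Finset.univ).mem_of_tendsto h (by
    filter_upwards [hev] with k hk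
    refine ⟨Sum.elim (fun i => max 0 (c k i)) (fun i => max 0 (-c k i)), ?_, ?_⟩
    · rintro (i | i) <;> exact le_max_left _ _
    · rw [Fintype.sum_sum_type, hA, ← Finset.sum_add_distrib]
      refine Finset.sum_congr rfl fun i _ => ?_
      simp only [Sum.elim_inl, Sum.elim_inr, v]
      rcases le_total 0 (c k i) with h0 | h0
      · rw [max_eq_right h0, max_eq_left (by linarith), zero_smul, add_zero]
        split_ifs with hp
        · rw [le_antisymm ((hk i).1 hp) h0]; simp
        · rfl
      · rw [max_eq_left h0, max_eq_right (by linarith), zero_smul, zero_add]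
        split_ifs with hp
        · rw [le_antisymm h0 ((hk i).2 hp)]; simp
        · simp)
  refine ⟨fun i => (if p i then 0 else d (Sum.inl i)) - (if m i then 0 else d (Sum.inr i)),
    ?_, fun i hi => ?_, fun i hi => ?_⟩
  · rw [hA, ← hdb, Fintype.sum_sum_type, ← Finset.sum_add_distrib]
    refine Finset.sum_congr rfl fun i _ => ?_
    simp only [Sum.elim_inl, Sum.elim_inr, v, sub_smul]
    split_ifs <;> simp [sub_eq_add_neg]
  · have hm : m i := hi
    simp only [hm, if_true, sub_zero]
    split_ifs
    exacts [le_rfl, hd _]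
  · have hp : p i := hi
    simp only [hp, if_true, zero_sub, Left.neg_nonpos_iff]
    split_ifs
    exacts [le_rfl, hd _]

/-! ### Normal cones and metric regularity -/

section Normals

variable {E F Ω : Type*} [NormedAddCommGroup E] [InnerProductSpace ℝ E]
  [NormedAddCommGroup F] [InnerProductSpace ℝ F]

/-- Limiting normals may be computed along arbitrary filters instead of sequences. -/
theorem mem_limitingNormalCone_of_tendsto {α : Type*} {l : Filter α} [l.NeBot] {Γ : Set F}
    {x ξ : F} (hx : x ∈ Γ) {y η : α → F} (hy : Tendsto y l (𝓝 x)) (hη : Tendsto η l (𝓝 ξ))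
    (h : ∀ᶠ k in l, η k ∈ regularNormalCone Γ (y k)) : ξ ∈ limitingNormalCone Γ x := by
  have hcl : (x, ξ) ∈ closure {z : F × F | z.2 ∈ regularNormalCone Γ z.1} :=
    mem_closure_of_tendsto (hy.prodMk_nhds hη) h
  obtain ⟨z, hz, hlim⟩ := mem_closure_iff_seq_limit.1 hcl
  exact ⟨hx, fun k => (z k).1, fun k => (z k).2, (continuous_fst.tendsto _).comp hlim,
    (continuous_snd.tendsto _).comp hlim, fun k => ⟨(hz k).1, hz k⟩⟩

/-- A regular normal makes a nonpositive inner product with each direction in which the set can be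
entered along a segment. -/
theorem inner_nonpos_of_mem_regularNormalCone {Γ : Set F} {p ξ d : F}
    (hξ : ξ ∈ regularNormalCone Γ p) {s₀ : ℝ} (hs₀ : 0 < s₀)
    (hd : ∀ s, 0 ≤ s → s ≤ s₀ → p + s • d ∈ Γ) : inner ℝ ξ d ≤ 0 := by
  have hmain : ∀ ε > (0 : ℝ), inner ℝ ξ d ≤ ε * ‖d‖ := fun ε hε => by
    have ht : Tendsto (fun s : ℝ => p + s • d) (𝓝[>] 0) (𝓝[Γ] p) := by
      refine tendsto_nhdsWithin_iff.2 ⟨?_, ?_⟩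
      · refine Tendsto.mono_left ?_ nhdsWithin_le_nhds
        have : Continuous fun s : ℝ => p + s • d := by fun_prop
        simpa using this.tendsto 0
      · filter_upwards [Ioc_mem_nhdsGT hs₀] with s hs using hd s hs.1.le hs.2
    obtain ⟨s, hs, hs0⟩ := ((ht.eventually (hξ.2 ε hε)).and self_mem_nhdsWithin).exists
    have hs0' : 0 < s := hs0
    rw [add_sub_cancel_left, inner_smul_right, norm_smul, Real.norm_of_nonneg hs0'.le] at hs
    exact le_of_mul_le_mul_left (by linarith [mul_left_comm ε s ‖d‖]) hs0'
  have hlim : Tendsto (fun ε : ℝ => ε * ‖d‖) (𝓝[>] 0) (𝓝 0) := by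
    refine Tendsto.mono_left ?_ nhdsWithin_le_nhds
    have : Continuous fun ε : ℝ => ε * ‖d‖ := by fun_prop
    simpa using this.tendsto 0
  exact ge_of_tendsto hlim (eventually_mem_nhdsWithin.mono fun ε hε => hmain ε hε)

theorem tendsto_clm_apply {α G H : Type*} [NormedAddCommGroup G] [NormedSpace ℝ G]
    [NormedAddCommGroup H] [NormedSpace ℝ H] {l : Filter α} {A : α → G →L[ℝ] H} {v : α → G}
    {A₀ : G →L[ℝ] H} {v₀ : G} (hA : Tendsto A l (𝓝 A₀)) (hv : Tendsto v l (𝓝 v₀)) :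
    Tendsto (fun k => A k (v k)) l (𝓝 (A₀ v₀)) :=
  (isBoundedBilinearMap_apply.continuous.tendsto (A₀, v₀)).comp (hA.prodMk_nhds hv)

variable [CompleteSpace E] [CompleteSpace F]

/-- Metric regularity of `x ↦ q(x) - P` bounds normals `λ` to `P` near `q(x)` by a multiple
of `∇q(x)ᵀ λ`: perturbing `y' = -tλ` forces a solution displacement of order `t`, along which the
regular normal `λ` has to gain `t ‖λ‖²`. -/
theorem MetricallyRegularAround.eventually_norm_le {q : E → Ω → F} {P : Set F} {ω : Ω} {κ : ℝ}
    {x : E} (hreg : MetricallyRegularAround (constraintMap q P ω) κ x 0) (hκ : 0 < κ)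
    {A : E →L[ℝ] F} (hA : HasFDerivAt (fun y => q y ω) A x) :
    ∀ᶠ p in 𝓝 (q x ω), ∀ η ∈ regularNormalCone P p,
      ‖η‖ ≤ 2 * κ * ‖ContinuousLinearMap.adjoint A η‖ := by
  obtain ⟨-, U, hU, V, hV, hUV⟩ := hreg
  have hVp : ∀ᶠ p in 𝓝 (q x ω), V ∈ 𝓝 (q x ω - p) := by
    have hc : Tendsto (fun p => q x ω - p) (𝓝 (q x ω)) (𝓝 0) := by
      have : Continuous fun p => q x ω - p := by fun_prop
      simpa using this.tendsto (q x ω)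
    exact hc.eventually (eventually_mem_nhds_iff.2 hV)
  filter_upwards [hVp] with p hp η hη
  by_cases hη0 : η = 0
  · simp [hη0]
  have hηpos : 0 < ‖η‖ := norm_pos_iff.2 hη0
  set a := ‖ContinuousLinearMap.adjoint A η‖ with ha
  set R : ℝ := 2 * κ * ‖η‖ with hR
  have hRpos : 0 < R := by positivity
  set K : ℝ := (‖A‖ + 1) * R + ‖η‖ with hK
  have hKpos : 0 < K := by positivity
  have key : ∀ ε : ℝ, 0 < ε → ε < 1 → ‖η‖ * ‖η‖ ≤ R * a + ε * (R * ‖η‖ + K) := by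
    intro ε hε hε1
    obtain ⟨r₁, hr₁, h₁⟩ := Metric.eventually_nhds_iff.1 (hA.isLittleO.def hε)
    obtain ⟨r₂, hr₂, h₂⟩ := Metric.eventually_nhds_iff.1
      (eventually_nhdsWithin_iff.1 (hη.2 ε hε))
    have hsmall : ∀ c r : ℝ, 0 < r → ∀ᶠ t in 𝓝[>] (0 : ℝ), t * c < r := fun c r hr => by
      have : Tendsto (fun t : ℝ => t * c) (𝓝 0) (𝓝 0) := by
        have : Continuous fun t : ℝ => t * c := by fun_prop
        simpa using this.tendsto 0
      exact nhdsWithin_le_nhds (this.eventually (gt_mem_nhds hr))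
    have hVt : ∀ᶠ t in 𝓝[>] (0 : ℝ), q x ω - p - t • η ∈ V := by
      have hc : Continuous fun t : ℝ => q x ω - p - t • η := by fun_prop
      refine nhdsWithin_le_nhds ((hc.tendsto 0).eventually ?_)
      simpa using hp
    obtain ⟨t, ⟨⟨⟨ht1, ht2⟩, htV⟩, ht0⟩⟩ := ((((hsmall R r₁ hr₁).and (hsmall K r₂ hr₂)).and
      hVt).and self_mem_nhdsWithin).exists
    have ht : 0 < t := ht0
    have hinf : Metric.infEDist x {z | q x ω - p - t • η ∈ constraintMap q P ω z} <
        ENNReal.ofReal (t * R) := by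
      refine (hUV x (mem_of_mem_nhds hU) _ htV).trans_lt ?_
      have h1 : Metric.infEDist (q x ω - p - t • η) (constraintMap q P ω x) ≤
          ENNReal.ofReal (t * ‖η‖) := by
        refine (Metric.infEDist_le_edist_of_mem
          (show q x ω - p ∈ constraintMap q P ω x from ⟨p, hη.1, rfl⟩)).trans ?_
        rw [edist_dist, dist_eq_norm]
        refine ENNReal.ofReal_le_ofReal ?_
        rw [sub_sub_cancel_left, norm_neg, norm_smul, Real.norm_of_nonneg ht.le]
      refine (mul_le_mul_right h1 _).trans_lt ?_
      rw [← ENNReal.ofReal_mul hκ.le]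
      refine (ENNReal.ofReal_lt_ofReal_iff (by positivity)).2 ?_
      have : 0 < κ * (t * ‖η‖) := by positivity
      rw [hR]
      linarith [show t * (2 * κ * ‖η‖) = 2 * (κ * (t * ‖η‖)) by ring]
    obtain ⟨z, ⟨p', hp', hzp⟩, hz⟩ := Metric.infEDist_lt_iff.1 hinf
    rw [edist_dist, ENNReal.ofReal_lt_ofReal_iff (by positivity), dist_comm] at hz
    have hzn : ‖z - x‖ ≤ t * R := by rw [← dist_eq_norm]; exact hz.le
    have hq := h₁ (hz.trans ht1)
    set w := q z ω - q x ω - A (z - x) with hw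
    have hwn : ‖w‖ ≤ ε * (t * R) := hq.trans (by gcongr)
    have hpp : p' - p = A (z - x) + w + t • η := by
      have : p' = q z ω - (q x ω - p - t • η) := by rw [hzp]; abel
      rw [this, hw]; abel
    have hppn : ‖p' - p‖ ≤ t * K := by
      rw [hpp]
      have e1 : ‖A (z - x)‖ ≤ ‖A‖ * (t * R) :=
        (A.le_opNorm _).trans (by gcongr)
      have e2 : ‖w‖ ≤ 1 * (t * R) := hwn.trans (by gcongr)
      have e3 : ‖t • η‖ = t * ‖η‖ := by rw [norm_smul, Real.norm_of_nonneg ht.le]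
      calc _ ≤ ‖A (z - x)‖ + ‖w‖ + ‖t • η‖ := norm_add₃_le
        _ ≤ ‖A‖ * (t * R) + 1 * (t * R) + t * ‖η‖ := by rw [e3]; gcongr
        _ = t * K := by rw [hK]; ring
    have hin := h₂ (by rw [dist_eq_norm]; exact hppn.trans_lt ht2) hp'
    have hin' : inner ℝ η (p' - p) ≤ ε * (t * K) := hin.trans (by gcongr)
    rw [hpp, inner_add_right, inner_add_right, inner_smul_right, real_inner_self_eq_norm_mul_norm,
      ← ContinuousLinearMap.adjoint_inner_left] at hin'
    have f1 := (abs_le.1 (abs_real_inner_le_norm (ContinuousLinearMap.adjoint A η) (z - x))).1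
    have f2 := (abs_le.1 (abs_real_inner_le_norm η w)).1
    have f3 : a * ‖z - x‖ ≤ a * (t * R) := by gcongr
    have f4 : ‖η‖ * ‖w‖ ≤ ‖η‖ * (ε * (t * R)) := by gcongr
    refine le_of_mul_le_mul_left ?_ ht
    nlinarith
  have hlim : Tendsto (fun ε : ℝ => R * a + ε * (R * ‖η‖ + K)) (𝓝[>] 0) (𝓝 (R * a)) := by
    refine Tendsto.mono_left ?_ nhdsWithin_le_nhds
    have : Continuous fun ε : ℝ => R * a + ε * (R * ‖η‖ + K) := by fun_prop
    simpa using this.tendsto 0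
  have hfin : ‖η‖ * ‖η‖ ≤ R * a := ge_of_tendsto hlim (by
    filter_upwards [Ioo_mem_nhdsGT one_pos] with ε hε using key ε hε.1 hε.2)
  refine le_of_mul_le_mul_left ?_ hηpos
  rw [hR] at hfin
  linarith [show 2 * κ * ‖η‖ * a = ‖η‖ * (2 * κ * a) by ring]

theorem norm_le_of_mem_limitingNormalCone {P : Set F} {p : F} {c : ℝ} {A : E →L[ℝ] F}
    (h : ∀ᶠ p' in 𝓝 p, ∀ η ∈ regularNormalCone P p', ‖η‖ ≤ c * ‖ContinuousLinearMap.adjoint A η‖)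
    {η : F} (hη : η ∈ limitingNormalCone P p) :
    ‖η‖ ≤ c * ‖ContinuousLinearMap.adjoint A η‖ := by
  obtain ⟨-, y, ζ, hy, hζ, hmem⟩ := hη
  refine le_of_tendsto_of_tendsto hζ.norm
    ((((ContinuousLinearMap.adjoint A).continuous.tendsto _).comp hζ).norm.const_mul c) ?_
  filter_upwards [hy.eventually h] with k hk using hk _ (hmem k).2

/-- Regular normals to `q⁻¹(P)` are approximated by the images under `∇q(x)ᵀ` of limiting normals
to `P`, provided that `∇q(x)ᵀ` is bounded below on the normals to `P` near `q(x)`. The multiplier is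
the limit of the multipliers `2k (q(y) - p)` of the penalized problems of minimizing
`-⟪ξ, y - x⟫ + ε ‖y - x‖ + k ‖q(y) - p‖²` over `y` near `x` and `p ∈ P` near `q(x)`. -/
theorem exists_limitingNormal_of_mem_regularNormalCone_preimage [FiniteDimensional ℝ E]
    [FiniteDimensional ℝ F] {q : E → F} {P : Set F} (hP : IsClosed P) {x : E}
    (hdiff : ∀ᶠ y in 𝓝 x, DifferentiableAt ℝ q y) (hcont : ContinuousAt (fderiv ℝ q) x)
    {c : ℝ} (hc : 0 < c)
    (hN : ∀ᶠ p in 𝓝 (q x), ∀ η ∈ regularNormalCone P p,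
      ‖η‖ ≤ c * ‖ContinuousLinearMap.adjoint (fderiv ℝ q x) η‖)
    {ξ : E} (hξ : ξ ∈ regularNormalCone {y | q y ∈ P} x) {ε : ℝ} (hε : 0 < ε) :
    ∃ η ∈ limitingNormalCone P (q x),
      ‖ξ - ContinuousLinearMap.adjoint (fderiv ℝ q x) η‖ ≤ ε := by
  have : ProperSpace E := FiniteDimensional.proper ℝ E
  have : ProperSpace F := FiniteDimensional.proper ℝ F
  have hxP : q x ∈ P := hξ.1
  obtain ⟨r, hr, hball⟩ := Metric.nhds_basis_closedBall.eventually_iff.1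
    (hdiff.and (eventually_nhdsWithin_iff.1 (hξ.2 (ε / 2) (half_pos hε))))
  have hqc : ∀ y ∈ Metric.closedBall x r, ContinuousAt q y :=
    fun y hy => (hball hy).1.continuousAt
  set K : Set (E × F) := Metric.closedBall x r ×ˢ (P ∩ Metric.closedBall (q x) 1) with hK
  have hKc : IsCompact K :=
    (isCompact_closedBall x r).prod ((isCompact_closedBall (q x) 1).inter_left hP)
  have hxK : (x, q x) ∈ K :=
    ⟨Metric.mem_closedBall_self hr.le, hxP, Metric.mem_closedBall_self zero_le_one⟩
  let Φ : ℕ → E × F → ℝ := fun k z =>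
    -inner ℝ ξ (z.1 - x) + ε * ‖z.1 - x‖ + k * ‖q z.1 - z.2‖ ^ 2
  have hΦc : ∀ k, ContinuousOn (Φ k) K := fun k z hz => by
    have h1 : ContinuousAt (fun z : E × F => q z.1) z :=
      ContinuousAt.comp (f := fun z : E × F => z.1) (hqc z.1 hz.1) continuousAt_fst
    have h2 : ContinuousAt (fun z : E × F => -inner ℝ ξ (z.1 - x) + ε * ‖z.1 - x‖) z := by fun_prop
    exact (h2.add (continuousAt_const.mul
      ((h1.sub continuousAt_snd).norm.pow 2))).continuousWithinAt
  have hmin : ∀ k, ∃ z ∈ K, IsMinOn (Φ k) K z := fun k =>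
    hKc.exists_isMinOn ⟨_, hxK⟩ (hΦc k)
  choose z hzK hzmin using hmin
  let 𝒰 : Ultrafilter ℕ := Filter.hyperfilter ℕ
  have h𝒰 : (𝒰 : Filter ℕ) ≤ atTop := Nat.hyperfilter_le_atTop
  obtain ⟨⟨y₀, p₀⟩, hz₀, hlim⟩ := isCompact_iff_ultrafilter_le_nhds'.1 hKc (𝒰.map z)
    (Ultrafilter.mem_map.2 (Filter.univ_mem' hzK))
  have hlim : Tendsto z 𝒰 (𝓝 (y₀, p₀)) := hlim
  have hy : Tendsto (fun k => (z k).1) 𝒰 (𝓝 y₀) := (continuous_fst.tendsto _).comp hlim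
  have hp : Tendsto (fun k => (z k).2) 𝒰 (𝓝 p₀) := (continuous_snd.tendsto _).comp hlim
  have hΦle : ∀ k, Φ k (z k) ≤ 0 := fun k => by
    have := hzmin k hxK
    simpa [Φ] using this
  have hqy : Tendsto (fun k => q (z k).1) 𝒰 (𝓝 (q y₀)) := (hqc y₀ hz₀.1).tendsto.comp hy
  -- the penalty term forces the limit point to be feasible
  have hfeas : q y₀ = p₀ := by
    have hle : ∀ᶠ k in (𝒰 : Filter ℕ), ‖q (z k).1 - (z k).2‖ ^ 2 ≤ ‖ξ‖ * r / k := by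
      filter_upwards [h𝒰 (eventually_gt_atTop 0)] with k hk
      have hk' : (0 : ℝ) < k := Nat.cast_pos.2 hk
      rw [le_div_iff₀ hk']
      have h1 := hΦle k
      have h2 := (real_inner_le_norm ξ ((z k).1 - x))
      have h3 : ‖(z k).1 - x‖ ≤ r := by
        rw [← dist_eq_norm]; exact (hzK k).1
      have h4 : ‖ξ‖ * ‖(z k).1 - x‖ ≤ ‖ξ‖ * r := by gcongr
      have h5 : 0 ≤ ε * ‖(z k).1 - x‖ := by positivity
      simp only [Φ] at h1
      linarith
    have h0 := (tendsto_const_div_atTop_nhds_zero_nat (‖ξ‖ * r)).mono_left h𝒰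
    have h1 := le_of_tendsto_of_tendsto ((hqy.sub hp).norm.pow 2) h0 hle
    have h2 : ‖q y₀ - p₀‖ ^ 2 = 0 := le_antisymm h1 (by positivity)
    exact sub_eq_zero.1 (norm_eq_zero.1 (pow_eq_zero_iff two_ne_zero |>.1 h2))
  have hy₀ : y₀ = x := by
    have h1 : -inner ℝ ξ (y₀ - x) + ε * ‖y₀ - x‖ ≤ 0 := by
      have hcont : Continuous fun y : E => -inner ℝ ξ (y - x) + ε * ‖y - x‖ := by fun_prop
      refine le_of_tendsto ((hcont.tendsto y₀).comp hy) (Eventually.of_forall fun k => ?_)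
      have h2 := hΦle k
      have h3 : 0 ≤ (k : ℝ) * ‖q (z k).1 - (z k).2‖ ^ 2 := by positivity
      simp only [Φ] at h2
      simp only [Function.comp]
      linarith
    have h2 := (hball hz₀.1).2 (show q y₀ ∈ P by rw [hfeas]; exact hz₀.2.1)
    have h3 : ‖y₀ - x‖ ≤ 0 := by nlinarith [norm_nonneg (y₀ - x)]
    exact sub_eq_zero.1 (norm_le_zero_iff.1 h3)
  subst hy₀
  rw [← hfeas] at hp
  let η : ℕ → F := fun k => (2 * k : ℝ) • (q (z k).1 - (z k).2)
  have hηN : ∀ᶠ k in (𝒰 : Filter ℕ), η k ∈ regularNormalCone P (z k).2 := by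
    filter_upwards [hp (Metric.ball_mem_nhds _ one_pos)] with k hk
    refine ⟨(hzK k).2.1, fun δ hδ => ?_⟩
    have hsm : ∀ᶠ p in 𝓝 (z k).2, k * ‖p - (z k).2‖ < δ := by
      have hcont : Continuous fun p : F => k * ‖p - (z k).2‖ := by fun_prop
      refine (hcont.tendsto (z k).2).eventually (gt_mem_nhds ?_)
      simpa using hδ
    filter_upwards [nhdsWithin_le_nhds hsm, nhdsWithin_le_nhds (Metric.isOpen_ball.mem_nhds hk),
      self_mem_nhdsWithin] with p h1 h2 h3
    have h4 := hzmin k (show ((z k).1, p) ∈ K from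
      ⟨(hzK k).1, h3, Metric.ball_subset_closedBall h2⟩)
    simp only [Φ, Set.mem_ofPred_eq] at h4
    have h5 : q (z k).1 - p = (q (z k).1 - (z k).2) - (p - (z k).2) := by abel
    rw [h5, norm_sub_sq_real (q (z k).1 - (z k).2) (p - (z k).2)] at h4
    simp only [η, inner_smul_left, conj_trivial]
    nlinarith [norm_nonneg (p - (z k).2)]
  have hηξ : ∀ᶠ k in (𝒰 : Filter ℕ),
      ‖ξ - ContinuousLinearMap.adjoint (fderiv ℝ q (z k).1) (η k)‖ ≤ ε := by
    filter_upwards [hy (Metric.ball_mem_nhds _ hr)] with k hk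
    have hD : HasFDerivAt q (fderiv ℝ q (z k).1) (z k).1 := (hball (hzK k).1).1.hasFDerivAt
    have hdir : ∀ d, inner ℝ (ξ - ContinuousLinearMap.adjoint (fderiv ℝ q (z k).1) (η k)) d ≤
        ε * ‖d‖ := fun d => by
      have hline : HasDerivAt (fun s : ℝ => (z k).1 + s • d) d 0 := by
        simpa using ((hasDerivAt_id (0 : ℝ)).smul_const d).const_add (z k).1
      have hcomp : HasDerivAt (fun s : ℝ => q ((z k).1 + s • d) - (z k).2)
          (fderiv ℝ q (z k).1 d) 0 := by
        refine HasDerivAt.sub_const _ (HasFDerivAt.comp_hasDerivAt (0 : ℝ) ?_ hline)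
        simpa using hD
      have hψ : HasDerivAt (fun s : ℝ => s * (-inner ℝ ξ d + ε * ‖d‖) +
          k * ‖q ((z k).1 + s • d) - (z k).2‖ ^ 2)
          (1 * (-inner ℝ ξ d + ε * ‖d‖) +
            k * (2 * inner ℝ (q (z k).1 - (z k).2) (fderiv ℝ q (z k).1 d))) 0 := by
        have := hcomp.norm_sq
        simp only [zero_smul, add_zero] at this
        exact ((hasDerivAt_id (0 : ℝ)).mul_const _).add (this.const_mul (k : ℝ))
      have hnn := ge_of_tendsto hψ.tendsto_slope_zero_right (b := 0) (by
        have hin : ∀ᶠ s in 𝓝[>] (0 : ℝ), (z k).1 + s • d ∈ Metric.ball y₀ r := by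
          refine nhdsWithin_le_nhds (hline.continuousAt.tendsto.eventually ?_)
          simp only [zero_smul, add_zero]
          exact Metric.isOpen_ball.mem_nhds hk
        filter_upwards [hin, self_mem_nhdsWithin] with s hs hs0
        have hs0' : 0 < s := hs0
        refine smul_nonneg (inv_nonneg.2 hs0'.le) ?_
        have h4 := hzmin k (show ((z k).1 + s • d, (z k).2) ∈ K from
          ⟨Metric.ball_subset_closedBall hs, (hzK k).2⟩)
        simp only [Φ, Set.mem_ofPred_eq] at h4
        have h5 : (z k).1 + s • d - y₀ = ((z k).1 - y₀) + s • d := by abel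
        have h6 : ‖((z k).1 - y₀) + s • d‖ ≤ ‖(z k).1 - y₀‖ + s * ‖d‖ :=
          (norm_add_le _ _).trans_eq (by rw [norm_smul, Real.norm_of_nonneg hs0'.le])
        have h7 := mul_le_mul_of_nonneg_left h6 hε.le
        rw [h5, inner_add_right, inner_smul_right] at h4
        simp only [zero_add, zero_mul, zero_smul, add_zero]
        nlinarith)
      rw [inner_sub_left, ContinuousLinearMap.adjoint_inner_left]
      simp only [η, inner_smul_left, conj_trivial]
      linarith
    have := hdir (ξ - ContinuousLinearMap.adjoint (fderiv ℝ q (z k).1) (η k))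
    rw [real_inner_self_eq_norm_mul_norm] at this
    rcases (norm_nonneg
      (ξ - ContinuousLinearMap.adjoint (fderiv ℝ q (z k).1) (η k))).eq_or_lt with h0 | h0
    · rw [← h0]; exact hε.le
    · exact le_of_mul_le_mul_right this h0
  have hDlim : Tendsto (fun k => fderiv ℝ q (z k).1) 𝒰 (𝓝 (fderiv ℝ q y₀)) :=
    hcont.tendsto.comp hy
  have hAlim : Tendsto (fun k => ContinuousLinearMap.adjoint (fderiv ℝ q (z k).1)) 𝒰
      (𝓝 (ContinuousLinearMap.adjoint (fderiv ℝ q y₀))) :=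
    (ContinuousLinearMap.adjoint.continuous.tendsto _).comp hDlim
  have hηb : ∀ᶠ k in (𝒰 : Filter ℕ), η k ∈ Metric.closedBall (0 : F) (2 * c * (‖ξ‖ + ε)) := by
    have hsm : ∀ᶠ k in (𝒰 : Filter ℕ), c * ‖ContinuousLinearMap.adjoint (fderiv ℝ q y₀) -
        ContinuousLinearMap.adjoint (fderiv ℝ q (z k).1)‖ < 1 / 2 := by
      have h1 := ((tendsto_const_nhds (x := ContinuousLinearMap.adjoint (fderiv ℝ q y₀))).sub
        hAlim).norm.const_mul c
      simp only [sub_self, norm_zero, mul_zero] at h1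
      exact h1.eventually (gt_mem_nhds (by norm_num))
    filter_upwards [hηN, hηξ, hsm, hp.eventually hN] with k h1 h2 h3 h4
    rw [mem_closedBall_zero_iff]
    set B := ContinuousLinearMap.adjoint (fderiv ℝ q (z k).1)
    set A := ContinuousLinearMap.adjoint (fderiv ℝ q y₀)
    have h5 := h4 _ h1
    have h6 : ‖A (η k)‖ ≤ ‖B (η k)‖ + ‖A - B‖ * ‖η k‖ := by
      have e : A (η k) = B (η k) + (A - B) (η k) := by simp
      rw [e]
      exact (norm_add_le _ _).trans (by gcongr; exact (A - B).le_opNorm _)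
    have h7 : ‖B (η k)‖ ≤ ‖ξ‖ + ε := by
      have e : B (η k) = ξ - (ξ - B (η k)) := by abel
      rw [e]
      exact (norm_sub_le _ _).trans (by gcongr)
    have h8 := mul_le_mul_of_nonneg_right h3.le (norm_nonneg (η k))
    have h9 := mul_le_mul_of_nonneg_left (h6.trans (add_le_add_left h7 _)) hc.le
    nlinarith
  obtain ⟨η₀, -, hη₀⟩ := isCompact_iff_ultrafilter_le_nhds'.1 (isCompact_closedBall _ _)
    (𝒰.map η) (Ultrafilter.mem_map.2 hηb)
  have hη₀ : Tendsto η 𝒰 (𝓝 η₀) := hη₀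
  exact ⟨η₀, mem_limitingNormalCone_of_tendsto hxP hp hη₀ hηN,
    le_of_tendsto (tendsto_const_nhds.sub (tendsto_clm_apply hAlim hη₀)).norm hηξ⟩

end Normals

/-! ### Tangents and normals to the constraint set of an MPEC -/

section MpecSet

variable {mI mE mC : ℕ}

/-- Tangents may be computed along arbitrary filters instead of sequences. -/
theorem mem_contingentCone_of_tendsto {α F : Type*} [NormedAddCommGroup F] [NormedSpace ℝ F]
    {l : Filter α} [l.NeBot] {Γ : Set F} {p d : F} (hp : p ∈ Γ) {t : α → ℝ} {y : α → F}
    (ht : ∀ᶠ k in l, 0 < t k) (ht0 : Tendsto t l (𝓝 0))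
    (hd : Tendsto (fun k => (t k)⁻¹ • (y k - p)) l (𝓝 d)) (hy : ∀ᶠ k in l, y k ∈ Γ) :
    d ∈ contingentCone Γ p := by
  have hcl : ((0 : ℝ), d) ∈ closure {z : ℝ × F | 0 < z.1 ∧ p + z.1 • z.2 ∈ Γ} := by
    refine mem_closure_of_tendsto (ht0.prodMk_nhds hd) ?_
    filter_upwards [ht, hy] with k h1 h2
    refine ⟨h1, ?_⟩
    rw [smul_inv_smul₀ h1.ne']
    simpa using h2
  obtain ⟨z, hz, hlim⟩ := mem_closure_iff_seq_limit.1 hcl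
  exact ⟨hp, fun k => (z k).1, fun k => (z k).2, fun k => (hz k).1,
    (continuous_fst.tendsto _).comp hlim, (continuous_snd.tendsto _).comp hlim, fun k => (hz k).2⟩

/-- `Q_EC` is a cone, hence contained in its tangent cone at the origin. -/
theorem mem_contingentCone_QEC {a : ℝ × ℝ} (ha : a ∈ QEC) : a ∈ contingentCone QEC (0, 0) := by
  refine ⟨by simp [QEC], fun k => 1 / ((k : ℝ) + 1), fun _ => a, fun k => by positivity,
    tendsto_one_div_add_atTop_nhds_zero_nat, tendsto_const_nhds, fun k => ?_⟩
  obtain ⟨h1, h2, h3⟩ := ha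
  have hk : (0 : ℝ) ≤ 1 / ((k : ℝ) + 1) := by positivity
  refine ⟨?_, ?_, ?_⟩
  · simpa using mul_nonpos_of_nonneg_of_nonpos hk h1
  · simpa using mul_nonpos_of_nonneg_of_nonpos hk h2
  · simp only [Prod.fst_add, Prod.snd_add, Prod.smul_fst, Prod.smul_snd, smul_eq_mul, zero_add]
    linear_combination (1 / ((k : ℝ) + 1)) ^ 2 * h3

theorem isClosed_mpecSet : IsClosed (mpecSet mI mE mC) := by
  have hc : ∀ i, Continuous fun y : CSpace mI mE mC => y i := fun i => by fun_prop
  simp only [mpecSet, QEC, Set.ofPred_and, Set.ofPred_forall]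
  refine (isClosed_iInter fun i => isClosed_le (hc (Sum.inl i)) continuous_const).inter
    ((isClosed_iInter fun i => isClosed_eq (hc (Sum.inr (Sum.inl i))) continuous_const).inter
      (isClosed_iInter fun i =>
        (isClosed_le (hc (Sum.inr (Sum.inr (i, 0)))) continuous_const).inter
        ((isClosed_le (hc (Sum.inr (Sum.inr (i, 1)))) continuous_const).inter
          (isClosed_eq ((hc (Sum.inr (Sum.inr (i, 0)))).mul (hc (Sum.inr (Sum.inr (i, 1)))))
            continuous_const))))

theorem nonpos_of_mem_mpecSet {p : CSpace mI mE mC} (hp : p ∈ mpecSet mI mE mC)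
    (i : Fin mI ⊕ Fin mE ⊕ (Fin mC × Fin 2)) : p i ≤ 0 := by
  rcases i with i | i | ⟨j, k⟩
  · exact hp.1 i
  · exact (hp.2.1 i).le
  · fin_cases k
    · exact (hp.2.2 j).1
    · exact (hp.2.2 j).2.1

theorem eq_zero_or_eq_zero_of_mem_mpecSet {p : CSpace mI mE mC} (hp : p ∈ mpecSet mI mE mC)
    (j : Fin mC) : p (Sum.inr (Sum.inr (j, 0))) = 0 ∨ p (Sum.inr (Sum.inr (j, 1))) = 0 :=
  mul_eq_zero.1 (hp.2.2 j).2.2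

/-- An inequality coordinate of a point of `P` may be changed to any other nonpositive value. -/
theorem add_single_inl_mem_mpecSet {p : CSpace mI mE mC} (hp : p ∈ mpecSet mI mE mC) (i : Fin mI)
    {s : ℝ} (hs : p (Sum.inl i) + s ≤ 0) :
    p + EuclideanSpace.single (Sum.inl i) s ∈ mpecSet mI mE mC := by
  refine ⟨fun i' => ?_, fun i' => ?_, fun j => ?_⟩
  · by_cases h : i' = i
    · subst h; simpa using hs
    · simpa [h] using hp.1 i'
  · simpa using hp.2.1 i'
  · simpa using hp.2.2 j

/-- A complementarity coordinate of a point of `P` may be changed to any other nonpositive value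
if its partner vanishes. -/
theorem add_single_inr_mem_mpecSet {p : CSpace mI mE mC} (hp : p ∈ mpecSet mI mE mC) (j : Fin mC)
    {k k' : Fin 2} (hk : k' ≠ k) (h0 : p (Sum.inr (Sum.inr (j, k'))) = 0)
    {s : ℝ} (hs : p (Sum.inr (Sum.inr (j, k))) + s ≤ 0) :
    p + EuclideanSpace.single (Sum.inr (Sum.inr (j, k))) s ∈ mpecSet mI mE mC := by
  refine ⟨fun i' => ?_, fun i' => ?_, fun j' => ?_⟩
  · simpa using hp.1 i'
  · simpa using hp.2.1 i'
  · by_cases h : j' = j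
    · subst h
      fin_cases k <;> fin_cases k' <;> simp_all [QEC]
    · simpa [h] using hp.2.2 j'

/-- The sign conditions satisfied by every limiting normal to `P`. -/
structure NormalSigns (p η : CSpace mI mE mC) : Prop where
  eq_zero : ∀ i, p i ≠ 0 → η i = 0
  nonneg : ∀ i, 0 ≤ η (Sum.inl i)
  pair : ∀ j, ((0 ≤ η (Sum.inr (Sum.inr (j, 0))) ∧ 0 ≤ η (Sum.inr (Sum.inr (j, 1)))) ∨
    η (Sum.inr (Sum.inr (j, 0))) = 0) ∨ η (Sum.inr (Sum.inr (j, 1))) = 0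

theorem normalSigns_of_mem_regularNormalCone {p η : CSpace mI mE mC}
    (hη : η ∈ regularNormalCone (mpecSet mI mE mC) p) : NormalSigns p η := by
  have hp := hη.1
  have hsingle : ∀ i (a s : ℝ), s • EuclideanSpace.single i a =
      (EuclideanSpace.single i (s * a) : CSpace mI mE mC) := fun i a s => by
    ext i'
    by_cases h : i' = i <;> simp [h]
  -- `eᵢ` or `-eᵢ` is a direction along which `P` can be entered
  have hup : ∀ i, p i < 0 → (∀ s, p i + s ≤ 0 → p + EuclideanSpace.single i s ∈ mpecSet mI mE mC) →
      η i ≤ 0 := fun i hi h => by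
    have := inner_nonpos_of_mem_regularNormalCone (d := EuclideanSpace.single i 1) hη
      (neg_pos.2 hi) (fun s _ hs => by rw [hsingle]; exact h _ (by linarith))
    rw [EuclideanSpace.inner_single_right] at this
    simpa using this
  have hdown : ∀ i, (∀ s, p i + s ≤ 0 → p + EuclideanSpace.single i s ∈ mpecSet mI mE mC) →
      0 ≤ η i := fun i h => by
    have := inner_nonpos_of_mem_regularNormalCone (d := EuclideanSpace.single i (-1)) hη
      one_pos (fun s hs _ => by
        rw [hsingle]; exact h _ (by linarith [nonpos_of_mem_mpecSet hp i]))
    rw [EuclideanSpace.inner_single_right] at this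
    simpa using this
  have hpair : ∀ j k k', k' ≠ k → p (Sum.inr (Sum.inr (j, k))) ≠ 0 →
      p (Sum.inr (Sum.inr (j, k'))) = 0 := fun j k k' hk h => by
    have h01 := eq_zero_or_eq_zero_of_mem_mpecSet hp j
    fin_cases k <;> fin_cases k'
    · exact absurd rfl hk
    · exact h01.resolve_left h
    · exact h01.resolve_right h
    · exact absurd rfl hk
  have hzero : ∀ j k, p (Sum.inr (Sum.inr (j, k))) ≠ 0 → η (Sum.inr (Sum.inr (j, k))) = 0 := by
    intro j k h
    obtain ⟨k', hk'⟩ := exists_ne k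
    have hmem : ∀ s, p (Sum.inr (Sum.inr (j, k))) + s ≤ 0 →
        p + EuclideanSpace.single (Sum.inr (Sum.inr (j, k))) s ∈ mpecSet mI mE mC := fun s hs =>
      add_single_inr_mem_mpecSet hp j hk' (hpair j k k' hk' h) hs
    exact le_antisymm (hup _ (lt_of_le_of_ne (nonpos_of_mem_mpecSet hp _) h) hmem) (hdown _ hmem)
  refine ⟨?_, fun i => hdown _ fun s hs => add_single_inl_mem_mpecSet hp i hs, fun j => ?_⟩
  · rintro (i | i | ⟨j, k⟩) h
    · exact le_antisymm (hup _ (lt_of_le_of_ne (hp.1 i) h) fun s hs =>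
        add_single_inl_mem_mpecSet hp i hs) (hdown _ fun s hs => add_single_inl_mem_mpecSet hp i hs)
    · exact absurd (hp.2.1 i) h
    · exact hzero j k h
  · by_cases h0 : p (Sum.inr (Sum.inr (j, 0))) = 0
    · by_cases h1 : p (Sum.inr (Sum.inr (j, 1))) = 0
      · exact Or.inl (Or.inl ⟨hdown _ fun s hs => add_single_inr_mem_mpecSet hp j (by decide) h1 hs,
          hdown _ fun s hs => add_single_inr_mem_mpecSet hp j (by decide) h0 hs⟩)
      · exact Or.inr (hzero j 1 h1)
    · exact Or.inl (Or.inr (hzero j 0 h0))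

/-- The sign conditions of `NormalSigns` at `p` are closed in the normal and are implied by those at
nearby points, so they pass from regular to limiting normals. -/
theorem normalSigns_of_mem_limitingNormalCone {p η : CSpace mI mE mC}
    (hη : η ∈ limitingNormalCone (mpecSet mI mE mC) p) : NormalSigns p η := by
  obtain ⟨-, y, ζ, hy, hζ, hmem⟩ := hη
  have hN := fun k => normalSigns_of_mem_regularNormalCone (hmem k).2
  have hyi : ∀ i, Tendsto (fun k => y k i) atTop (𝓝 (p i)) := fun i =>
    ((by fun_prop : Continuous fun z : CSpace mI mE mC => z i).tendsto p).comp hy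
  have hζi : ∀ i, Tendsto (fun k => ζ k i) atTop (𝓝 (η i)) := fun i =>
    ((by fun_prop : Continuous fun z : CSpace mI mE mC => z i).tendsto η).comp hζ
  refine ⟨fun i hi => ?_, fun i => ge_of_tendsto (hζi _)
    (Eventually.of_forall fun k => (hN k).nonneg i), fun j => ?_⟩
  · refine tendsto_nhds_unique ((hζi i).congr' ?_) tendsto_const_nhds
    filter_upwards [(hyi i).eventually_ne hi] with k hk using (hN k).eq_zero i hk
  · have hcl : IsClosed {a : ℝ × ℝ | ((0 ≤ a.1 ∧ 0 ≤ a.2) ∨ a.1 = 0) ∨ a.2 = 0} :=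
      (((isClosed_le continuous_const continuous_fst).inter
        (isClosed_le continuous_const continuous_snd)).union
        (isClosed_eq continuous_fst continuous_const)).union
        (isClosed_eq continuous_snd continuous_const)
    exact hcl.mem_of_tendsto ((hζi _).prodMk_nhds (hζi _))
      (Eventually.of_forall fun k => (hN k).pair j)

end MpecSet

/-! ### Parametric Taylor expansions -/

section Taylor

variable {E G Ω : Type*} [NormedAddCommGroup E] [NormedSpace ℝ E] [NormedAddCommGroup G]
  [NormedSpace ℝ G] [TopologicalSpace Ω] {ψ : E → Ω → G} {xb : E} {ob : Ω}

/-- First-order expansion in `x`, uniformly in the parameter. -/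
theorem isLittleO_sub_sub_fderiv
    (hd : ∀ᶠ p in 𝓝 (xb, ob), DifferentiableAt ℝ (fun y => ψ y p.2) p.1)
    (hc : ContinuousAt (fun p : E × Ω => fderiv ℝ (fun y => ψ y p.2) p.1) (xb, ob)) :
    (fun p : E × Ω => ψ p.1 p.2 - ψ xb p.2 - fderiv ℝ (fun y => ψ y ob) xb (p.1 - xb))
      =o[𝓝 (xb, ob)] fun p => p.1 - xb := by
  refine Asymptotics.isLittleO_iff.2 fun ε hε => ?_
  have hb : ∀ᶠ p in 𝓝 (xb, ob),
      ‖fderiv ℝ (fun y => ψ y p.2) p.1 - fderiv ℝ (fun y => ψ y ob) xb‖ ≤ ε := by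
    filter_upwards [hc.eventually (Metric.closedBall_mem_nhds _ hε)] with p hp
    rwa [← dist_eq_norm]
  have hev := hd.and hb
  rw [nhds_prod_eq] at hev ⊢
  obtain ⟨pa, hpa, pb, hpb, h⟩ := eventually_prod_iff.1 hev
  obtain ⟨r, hr, hball⟩ := Metric.eventually_nhds_iff_ball.1 hpa
  filter_upwards [prod_mem_prod (Metric.ball_mem_nhds xb hr) hpb] with p hp
  exact (convex_ball xb r).norm_image_sub_le_of_norm_fderiv_le' (f := fun y => ψ y p.2)
    (fun y hy => (h (hball y hy) hp.2).1) (fun y hy => (h (hball y hy) hp.2).2)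
    (Metric.mem_ball_self hr) hp.1

/-- Second-order expansion in `x`, uniformly in the parameter. -/
theorem isLittleO_sub_sub_fderiv_sub_fderiv_fderiv
    (hd : ∀ᶠ p in 𝓝 (xb, ob), DifferentiableAt ℝ (fun y => ψ y p.2) p.1)
    (hd2 : ∀ᶠ p in 𝓝 (xb, ob),
      DifferentiableAt ℝ (fun y => fderiv ℝ (fun z => ψ z p.2) y) p.1)
    (hc2 : ContinuousAt
      (fun p : E × Ω => fderiv ℝ (fun y => fderiv ℝ (fun z => ψ z p.2) y) p.1) (xb, ob))
    (hsymm : ∀ v w, fderiv ℝ (fun y => fderiv ℝ (fun z => ψ z ob) y) xb v w =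
      fderiv ℝ (fun y => fderiv ℝ (fun z => ψ z ob) y) xb w v) :
    (fun p : E × Ω => ψ p.1 p.2 - ψ xb p.2 - fderiv ℝ (fun y => ψ y p.2) xb (p.1 - xb) -
        (2⁻¹ : ℝ) • fderiv ℝ (fun y => fderiv ℝ (fun z => ψ z ob) y) xb (p.1 - xb) (p.1 - xb))
      =o[𝓝 (xb, ob)] fun p => ‖p.1 - xb‖ ^ 2 := by
  set B := fderiv ℝ (fun y => fderiv ℝ (fun z => ψ z ob) y) xb with hB
  refine Asymptotics.isLittleO_iff.2 fun ε hε => ?_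
  have hb := Asymptotics.isLittleO_iff.1
    (isLittleO_sub_sub_fderiv (ψ := fun y ω => fderiv ℝ (fun z => ψ z ω) y) hd2 hc2) hε
  have hev := hd.and hb
  rw [nhds_prod_eq] at hev ⊢
  obtain ⟨pa, hpa, pb, hpb, h⟩ := eventually_prod_iff.1 hev
  obtain ⟨r, hr, hball⟩ := Metric.eventually_nhds_iff_ball.1 hpa
  filter_upwards [prod_mem_prod (Metric.ball_mem_nhds xb hr) hpb] with p hp
  have hsub : ∀ y ∈ Metric.closedBall xb ‖p.1 - xb‖, y ∈ Metric.ball xb r := fun y hy =>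
    (Metric.mem_closedBall.1 hy).trans_lt (by rw [← dist_eq_norm]; exact hp.1)
  have hder : ∀ y ∈ Metric.closedBall xb ‖p.1 - xb‖,
      HasFDerivWithinAt (fun y => ψ y p.2 - fderiv ℝ (fun y => ψ y p.2) xb (y - xb) -
        (2⁻¹ : ℝ) • B (y - xb) (y - xb))
        (fderiv ℝ (fun z => ψ z p.2) y - fderiv ℝ (fun z => ψ z p.2) xb - B (y - xb))
        (Metric.closedBall xb ‖p.1 - xb‖) y := fun y hy => by
    have h1 : HasFDerivAt (fun y => ψ y p.2) _ y := (h (hball y (hsub y hy)) hp.2).1.hasFDerivAt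
    have h0 : HasFDerivAt (fun y : E => y - xb) (ContinuousLinearMap.id ℝ E) y :=
      (hasFDerivAt_id y).sub_const xb
    have h2 := (fderiv ℝ (fun y => ψ y p.2) xb).hasFDerivAt.comp y h0
    have h3 := ((B.hasFDerivAt.comp y h0).clm_apply h0).const_smul (2⁻¹ : ℝ)
    refine ((h1.sub h2).sub h3).hasFDerivWithinAt.congr_fderiv ?_
    ext v
    simp only [ContinuousLinearMap.comp_id, sub_apply,
      smul_apply, add_apply, ContinuousLinearMap.flip_apply,
      Function.comp_apply]
    rw [hsymm v (y - xb), ← two_smul ℝ (B (y - xb) v), smul_smul]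
    norm_num
  have hbd : ∀ y ∈ Metric.closedBall xb ‖p.1 - xb‖,
      ‖fderiv ℝ (fun z => ψ z p.2) y - fderiv ℝ (fun z => ψ z p.2) xb - B (y - xb)‖ ≤
        ε * ‖p.1 - xb‖ := fun y hy => by
    refine (h (hball y (hsub y hy)) hp.2).2.trans ?_
    have : ‖y - xb‖ ≤ ‖p.1 - xb‖ := by rw [← dist_eq_norm]; exact hy
    gcongr
  have hfin := (convex_closedBall xb ‖p.1 - xb‖).norm_image_sub_le_of_norm_hasFDerivWithin_le
    hder hbd (Metric.mem_closedBall_self (norm_nonneg _))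
    (show p.1 ∈ _ by rw [Metric.mem_closedBall, dist_eq_norm])
  rw [Real.norm_of_nonneg (by positivity)]
  calc _ = _ := ?_
    _ ≤ _ := hfin
    _ = _ := by ring
  congr 1
  simp only [sub_self, map_zero, smul_zero, sub_zero]
  abel

end Taylor

/-! ### Derivatives of linear combinations of the data -/

section Derivatives

variable {E F Ω : Type*} [NormedAddCommGroup E] [InnerProductSpace ℝ E]
  [NormedAddCommGroup F] [InnerProductSpace ℝ F] {f : E → Ω → ℝ} {q : E → Ω → F} {x : E} {ω : Ω}

theorem differentiableAt_jacX (h : ContDiffAt ℝ 2 (fun y => q y ω) x) :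
    DifferentiableAt ℝ (fun y => jacX q y ω) x :=
  (h.fderiv_right (m := 1) (by norm_num)).differentiableAt (by norm_num)

theorem BasicAssumption.eventually_contDiffAt [CompleteSpace E] [TopologicalSpace Ω] {xb : E}
    {ob : Ω} (h : BasicAssumption f q xb ob) : ∀ᶠ p in 𝓝 (xb, ob),
      ContDiffAt ℝ 2 (fun y => f y p.2) p.1 ∧ ContDiffAt ℝ 2 (fun y => q y p.2) p.1 := by
  obtain ⟨U, hU, hxU, W, hW, hUW⟩ := h.contDiff_near
  filter_upwards [prod_mem_nhds (hU.mem_nhds hxU) hW] with p hp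
  exact ⟨(hUW p.2 hp.2).1.contDiffAt (hU.mem_nhds hp.1),
    (hUW p.2 hp.2).2.contDiffAt (hU.mem_nhds hp.1)⟩

variable [CompleteSpace E] [CompleteSpace F]

theorem gradX_eq_of_eq_add_inner {φ : E → Ω → ℝ} {l₀ : ℝ} {y : F}
    (hφ : ∀ x, φ x ω = l₀ * f x ω + inner ℝ y (q x ω))
    (hf : DifferentiableAt ℝ (fun y => f y ω) x) (hq : DifferentiableAt ℝ (fun y => q y ω) x) :
    gradX φ x ω = l₀ • gradX f x ω + ContinuousLinearMap.adjoint (jacX q x ω) y := by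
  refine HasGradientAt.gradient (hasGradientAt_iff_hasFDerivAt.2 ?_)
  have h1 : HasFDerivAt (fun z => l₀ * f z ω + inner ℝ y (q z ω))
      (l₀ • fderiv ℝ (fun y => f y ω) x + (innerSL ℝ y).comp (jacX q x ω)) x :=
    (hf.hasFDerivAt.const_mul l₀).add ((innerSL ℝ y).hasFDerivAt.comp x hq.hasFDerivAt)
  simp_rw [hφ]
  refine h1.congr_fderiv ?_
  ext v
  simp only [add_apply, smul_apply, ContinuousLinearMap.comp_apply, innerSL_apply_apply,
    InnerProductSpace.toDual_apply_apply, inner_add_left, inner_smul_left, conj_trivial,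
    ContinuousLinearMap.adjoint_inner_left, smul_eq_mul]
  rw [gradX, gradient, InnerProductSpace.toDual_symm_apply]

variable [FiniteDimensional ℝ E]

/-- The inverse Riesz isomorphism as a linear map; over `ℝ` its conjugate-linearity is linearity. -/
def rieszCLM (E : Type*) [NormedAddCommGroup E] [InnerProductSpace ℝ E] [CompleteSpace E]
    [FiniteDimensional ℝ E] : (E →L[ℝ] ℝ) →L[ℝ] E :=
  LinearMap.toContinuousLinearMap
    { toFun := fun A => (InnerProductSpace.toDual ℝ E).symm A
      map_add' := fun A B => map_add _ A B
      map_smul' := fun c A => by simp }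

theorem differentiableAt_gradX (h : ContDiffAt ℝ 2 (fun y => f y ω) x) :
    DifferentiableAt ℝ (fun y => gradX f y ω) x := by
  have h1 : DifferentiableAt ℝ (fderiv ℝ fun y => f y ω) x :=
    (h.fderiv_right (m := 1) (by norm_num)).differentiableAt (by norm_num)
  exact (rieszCLM E).differentiableAt.comp x h1

variable [FiniteDimensional ℝ F]

/-- The linear map `J ↦ Jᵀ y`. -/
def adjointApplyCLM (E : Type*) [NormedAddCommGroup E] [InnerProductSpace ℝ E] [CompleteSpace E]
    [FiniteDimensional ℝ E] (y : F) : (E →L[ℝ] F) →L[ℝ] E :=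
  LinearMap.toContinuousLinearMap
    { toFun := fun J => ContinuousLinearMap.adjoint J y
      map_add' := fun A B => by simp
      map_smul' := fun c A => by simp }

theorem adjointApplyCLM_apply (y : F) (J : E →L[ℝ] F) :
    adjointApplyCLM E y J = ContinuousLinearMap.adjoint J y := rfl

theorem hessX_eq_of_eq_add_inner {φ : E → Ω → ℝ} {l₀ : ℝ} {y : F}
    (hφ : ∀ x, φ x ω = l₀ * f x ω + inner ℝ y (q x ω))
    (hf : ContDiffAt ℝ 2 (fun y => f y ω) x) (hq : ContDiffAt ℝ 2 (fun y => q y ω) x) (v : E) :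
    hessX φ x ω v = l₀ • hessX f x ω v + ContinuousLinearMap.adjoint (jac2X q x ω v) y := by
  have hev : (fun z => gradX φ z ω) =ᶠ[𝓝 x]
      fun z => l₀ • gradX f z ω + adjointApplyCLM E y (jacX q z ω) := by
    filter_upwards [hf.eventually (by simp), hq.eventually (by simp)] with z h1 h2
    rw [adjointApplyCLM_apply]
    exact gradX_eq_of_eq_add_inner hφ (h1.differentiableAt (by norm_num))
      (h2.differentiableAt (by norm_num))
  have h1 : HasFDerivAt (fun z => l₀ • gradX f z ω + adjointApplyCLM E y (jacX q z ω))
      (l₀ • hessX f x ω + (adjointApplyCLM E y).comp (jac2X q x ω)) x :=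
    ((differentiableAt_gradX hf).hasFDerivAt.const_smul l₀).add
      ((adjointApplyCLM E y).hasFDerivAt.comp x (differentiableAt_jacX hq).hasFDerivAt)
  rw [hessX, hev.fderiv_eq, h1.fderiv, add_apply, smul_apply, ContinuousLinearMap.comp_apply,
    adjointApplyCLM_apply]

end Derivatives

/-! ### Multipliers as vectors -/

/-- The multiplier as an element of the constraint space, in the coordinates dual to those
of `q`. -/
def Multiplier.toVec {mI mE mC : ℕ} (lam : Multiplier mI mE mC) : CSpace mI mE mC :=
  WithLp.toLp 2 (Sum.elim lam.g (Sum.elim lam.h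
    (fun j => if j.2 = 0 then lam.G j.1 else lam.H j.1)))

/-- The multiplier whose vector is `y`. -/
def Multiplier.ofVec {mI mE mC : ℕ} (y : CSpace mI mE mC) : Multiplier mI mE mC where
  g i := y (Sum.inl i)
  h i := y (Sum.inr (Sum.inl i))
  G i := y (Sum.inr (Sum.inr (i, 0)))
  H i := y (Sum.inr (Sum.inr (i, 1)))

theorem Multiplier.toVec_ofVec {mI mE mC : ℕ} (y : CSpace mI mE mC) :
    (Multiplier.ofVec y).toVec = y := by
  ext i
  rcases i with i | i | ⟨j, k⟩
  · rfl
  · rfl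
  · fin_cases k <;> rfl

namespace MPEC

variable {n mI mE mC : ℕ} {Ω : Type*} (D : MPEC n mI mE mC Ω)

theorem lagrangian_eq (l₀ : ℝ) (lam : Multiplier mI mE mC) (x : EuclideanSpace ℝ (Fin n)) (ω : Ω) :
    D.lagrangian l₀ lam x ω = l₀ * D.f x ω + inner ℝ lam.toVec (D.q x ω) := by
  simp only [lagrangian, PiLp.inner_apply, Fintype.sum_sum_type, Fintype.sum_prod_type,
    Fin.sum_univ_two, Multiplier.toVec, q, Sum.elim_inl, Sum.elim_inr, if_true, one_ne_zero,
    if_false, RCLike.inner_apply, conj_trivial]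
  rw [add_assoc, sub_eq_add_neg, ← Finset.sum_neg_distrib]
  rw [add_assoc (l₀ * D.f x ω)]
  congr 1
  rw [← add_assoc (∑ i, D.g i x ω * lam.g i)]
  congr 1
  · congr 1 <;> exact Finset.sum_congr rfl fun i _ => mul_comm _ _
  · exact Finset.sum_congr rfl fun i _ => by ring

variable {D} {xb : EuclideanSpace ℝ (Fin n)} {ob : Ω}

theorem g_eq_inner (i : Fin mI) (x : EuclideanSpace ℝ (Fin n)) :
    D.g i x ob = inner ℝ (EuclideanSpace.single (Sum.inl i) (1 : ℝ)) (D.q x ob) := by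
  rw [EuclideanSpace.inner_single_left]; simp [q]

theorem h_eq_inner (i : Fin mE) (x : EuclideanSpace ℝ (Fin n)) :
    D.h i x ob = inner ℝ (EuclideanSpace.single (Sum.inr (Sum.inl i)) (1 : ℝ)) (D.q x ob) := by
  rw [EuclideanSpace.inner_single_left]; simp [q]

theorem G_eq_inner (i : Fin mC) (x : EuclideanSpace ℝ (Fin n)) :
    D.G i x ob =
      inner ℝ (EuclideanSpace.single (Sum.inr (Sum.inr (i, 0))) (-1 : ℝ)) (D.q x ob) := by
  rw [EuclideanSpace.inner_single_left]; simp [q]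

theorem H_eq_inner (i : Fin mC) (x : EuclideanSpace ℝ (Fin n)) :
    D.H i x ob =
      inner ℝ (EuclideanSpace.single (Sum.inr (Sum.inr (i, 1))) (-1 : ℝ)) (D.q x ob) := by
  rw [EuclideanSpace.inner_single_left]; simp [q]

variable [TopologicalSpace Ω]

/-- First derivatives of the scalarization `⟪y, q⟫`. -/
theorem inner_gradX_of_eq_inner (hD : BasicAssumption D.f D.q xb ob)
    {φ : EuclideanSpace ℝ (Fin n) → Ω → ℝ} {y : CSpace mI mE mC}
    (hφ : ∀ x, φ x ob = inner ℝ y (D.q x ob)) (v : EuclideanSpace ℝ (Fin n)) :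
    inner ℝ (gradX φ xb ob) v = inner ℝ y (jacX D.q xb ob v) := by
  obtain ⟨h1, h2⟩ := hD.eventually_contDiffAt.self_of_nhds
  rw [gradX_eq_of_eq_add_inner (f := D.f) (l₀ := 0) (y := y) (fun x => by rw [hφ]; ring)
    (h1.differentiableAt (by norm_num)) (h2.differentiableAt (by norm_num)), zero_smul, zero_add,
    ContinuousLinearMap.adjoint_inner_left]

theorem secondOrderTerm_of_eq_inner (hD : BasicAssumption D.f D.q xb ob)
    {φ : EuclideanSpace ℝ (Fin n) → Ω → ℝ} {y : CSpace mI mE mC}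
    (hφ : ∀ x, φ x ob = inner ℝ y (D.q x ob)) (u ν : EuclideanSpace ℝ (Fin n)) :
    secondOrderTerm xb ob u φ ν = inner ℝ y (jacX D.q xb ob ν + jac2X D.q xb ob u u) := by
  obtain ⟨h1, h2⟩ := hD.eventually_contDiffAt.self_of_nhds
  rw [secondOrderTerm, inner_gradX_of_eq_inner hD hφ, hessX_eq_of_eq_add_inner (f := D.f)
    (l₀ := 0) (y := y) (fun x => by rw [hφ]; ring) h1 h2, zero_smul, zero_add,
    ContinuousLinearMap.adjoint_inner_right, inner_add_right, real_inner_comm y]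

theorem inner_gradX_g (hD : BasicAssumption D.f D.q xb ob)
    (u : EuclideanSpace ℝ (Fin n)) (i : Fin mI) :
    inner ℝ (gradX (D.g i) xb ob) u = jacX D.q xb ob u (Sum.inl i) := by
  rw [inner_gradX_of_eq_inner hD (g_eq_inner i), EuclideanSpace.inner_single_left]; simp

theorem inner_gradX_G (hD : BasicAssumption D.f D.q xb ob)
    (u : EuclideanSpace ℝ (Fin n)) (i : Fin mC) :
    inner ℝ (gradX (D.G i) xb ob) u = -jacX D.q xb ob u (Sum.inr (Sum.inr (i, 0))) := by
  rw [inner_gradX_of_eq_inner hD (G_eq_inner i), EuclideanSpace.inner_single_left]; simp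

theorem inner_gradX_H (hD : BasicAssumption D.f D.q xb ob)
    (u : EuclideanSpace ℝ (Fin n)) (i : Fin mC) :
    inner ℝ (gradX (D.H i) xb ob) u = -jacX D.q xb ob u (Sum.inr (Sum.inr (i, 1))) := by
  rw [inner_gradX_of_eq_inner hD (H_eq_inner i), EuclideanSpace.inner_single_left]; simp

theorem secondOrderTerm_g (hD : BasicAssumption D.f D.q xb ob)
    (u ν : EuclideanSpace ℝ (Fin n)) (i : Fin mI) :
    secondOrderTerm xb ob u (D.g i) ν =
    (jacX D.q xb ob ν + jac2X D.q xb ob u u) (Sum.inl i) := by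
  rw [secondOrderTerm_of_eq_inner hD (g_eq_inner i), EuclideanSpace.inner_single_left]; simp

theorem secondOrderTerm_h (hD : BasicAssumption D.f D.q xb ob)
    (u ν : EuclideanSpace ℝ (Fin n)) (i : Fin mE) :
    secondOrderTerm xb ob u (D.h i) ν =
    (jacX D.q xb ob ν + jac2X D.q xb ob u u) (Sum.inr (Sum.inl i)) := by
  rw [secondOrderTerm_of_eq_inner hD (h_eq_inner i), EuclideanSpace.inner_single_left]; simp

theorem secondOrderTerm_G (hD : BasicAssumption D.f D.q xb ob)
    (u ν : EuclideanSpace ℝ (Fin n)) (i : Fin mC) :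
    secondOrderTerm xb ob u (D.G i) ν =
    -(jacX D.q xb ob ν + jac2X D.q xb ob u u) (Sum.inr (Sum.inr (i, 0))) := by
  rw [secondOrderTerm_of_eq_inner hD (G_eq_inner i), EuclideanSpace.inner_single_left]; simp

theorem secondOrderTerm_H (hD : BasicAssumption D.f D.q xb ob)
    (u ν : EuclideanSpace ℝ (Fin n)) (i : Fin mC) :
    secondOrderTerm xb ob u (D.H i) ν =
    -(jacX D.q xb ob ν + jac2X D.q xb ob u u) (Sum.inr (Sum.inr (i, 1))) := by
  rw [secondOrderTerm_of_eq_inner hD (H_eq_inner i), EuclideanSpace.inner_single_left]; simp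

end MPEC

/-! ### Passage to the limit along an ultrafilter -/

section Limits

variable {α : Type*} {t : α → ℝ}

theorem tendsto_of_tendsto_inv_smul {V : Type*} [NormedAddCommGroup V] [NormedSpace ℝ V]
    {l : Filter α} (ht : ∀ᶠ k in l, 0 < t k) (ht0 : Tendsto t l (𝓝 0)) {y : α → V} {y₀ v : V}
    (h : Tendsto (fun k => (t k)⁻¹ • (y k - y₀)) l (𝓝 v)) : Tendsto y l (𝓝 y₀) := by
  have h1 := (ht0.smul h).const_add y₀
  rw [zero_smul, add_zero] at h1
  refine h1.congr' ?_
  filter_upwards [ht] with k hk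
  rw [smul_inv_smul₀ hk.ne', add_sub_cancel]

variable {𝒰 : Ultrafilter α} {n mI mE mC : ℕ} {E : Type*} [NormedAddCommGroup E]
  [InnerProductSpace ℝ E] [CompleteSpace E] {Qk ηk : α → CSpace mI mE mC}
  {qb v η : CSpace mI mE mC}

theorem tendsto_coord {l : Filter α} {y : α → CSpace mI mE mC} {y₀ : CSpace mI mE mC}
    (h : Tendsto y l (𝓝 y₀)) (i : Fin mI ⊕ Fin mE ⊕ (Fin mC × Fin 2)) :
    Tendsto (fun k => y k i) l (𝓝 (y₀ i)) :=
  ((by fun_prop : Continuous fun z : CSpace mI mE mC => z i).tendsto y₀).comp h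

theorem eventually_coord_ne_zero {l : Filter α} (ht : ∀ᶠ k in l, 0 < t k)
    (ht0 : Tendsto t l (𝓝 0)) (hQ : Tendsto (fun k => (t k)⁻¹ • (Qk k - qb)) l (𝓝 v))
    {i : Fin mI ⊕ Fin mE ⊕ (Fin mC × Fin 2)} (h : qb i ≠ 0 ∨ v i ≠ 0) :
    ∀ᶠ k in l, Qk k i ≠ 0 := by
  by_cases hq : qb i = 0
  · filter_upwards [(tendsto_coord hQ i).eventually_ne (h.resolve_left (not_not.2 hq))] with k hk h0
    simp [h0, hq] at hk
  · exact (tendsto_coord (tendsto_of_tendsto_inv_smul ht ht0 hQ) i).eventually_ne hq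

/-- A constraint that is active along the filter is active at the limit, and stays so to first
order in the limiting direction. -/
theorem coord_eq_zero_of_eventually {l : Filter α} [l.NeBot] (ht : ∀ᶠ k in l, 0 < t k)
    (ht0 : Tendsto t l (𝓝 0)) (hQ : Tendsto (fun k => (t k)⁻¹ • (Qk k - qb)) l (𝓝 v))
    {i : Fin mI ⊕ Fin mE ⊕ (Fin mC × Fin 2)} (h : ∀ᶠ k in l, Qk k i = 0) :
    qb i = 0 ∧ v i = 0 := by
  by_contra hne
  rw [not_and_or] at hne
  obtain ⟨k, h1, h2⟩ := (h.and (eventually_coord_ne_zero ht ht0 hQ hne)).exists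
  exact h2 h1

/-- The sign conditions on a pair `(λ, μ)` of multiplier vectors, where `qb` is the reference value
of the constraints and `v` their derivative in the critical direction. For a complementarity pair,
either one coordinate of both multipliers vanishes, or both coordinates behave like inequality
multipliers. -/
structure DirectionalSigns (qb v lam mu : CSpace mI mE mC) : Prop where
  eq_zero : ∀ i, (qb i ≠ 0 ∨ v i ≠ 0) → lam i = 0 ∧ mu i = 0
  nonneg : ∀ i, 0 ≤ lam (Sum.inl i) ∧ (lam (Sum.inl i) = 0 → 0 ≤ mu (Sum.inl i))
  pair : ∀ j, (∃ k, lam (Sum.inr (Sum.inr (j, k))) = 0 ∧ mu (Sum.inr (Sum.inr (j, k))) = 0) ∨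
    ∀ k, 0 ≤ lam (Sum.inr (Sum.inr (j, k))) ∧
      (lam (Sum.inr (Sum.inr (j, k))) = 0 → 0 ≤ mu (Sum.inr (Sum.inr (j, k))))

/-- Multipliers `λ_k → λ` of stationary points yield, besides the stationarity condition for `λ`,
a second multiplier `μ` which solves the linearized stationarity condition. The difference quotients
`(λ_k - λ) / t_k` need not be bounded, but only their images under `Aᵀ` have to converge. -/
theorem exists_tangent_multiplier (ht : ∀ᶠ k in (𝒰 : Filter α), 0 < t k)
    (ht0 : Tendsto t 𝒰 (𝓝 0))
    {gk : α → E} {gb hf : E} {Jk : α → E →L[ℝ] CSpace mI mE mC} {A Bu : E →L[ℝ] CSpace mI mE mC}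
    (hg : Tendsto (fun k => (t k)⁻¹ • (gk k - gb)) 𝒰 (𝓝 hf))
    (hJ : Tendsto (fun k => (t k)⁻¹ • (Jk k - A)) 𝒰 (𝓝 Bu))
    (hQ : Tendsto (fun k => (t k)⁻¹ • (Qk k - qb)) 𝒰 (𝓝 v))
    (hη : Tendsto ηk 𝒰 (𝓝 η)) (hN : ∀ᶠ k in (𝒰 : Filter α), NormalSigns (Qk k) (ηk k))
    (hstat : Tendsto (fun k => (t k)⁻¹ • (gk k + ContinuousLinearMap.adjoint (Jk k) (ηk k)))
      𝒰 (𝓝 0)) :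
    gb + ContinuousLinearMap.adjoint A η = 0 ∧ ∃ μ : CSpace mI mE mC,
      hf + ContinuousLinearMap.adjoint Bu η + ContinuousLinearMap.adjoint A μ = 0 ∧
      DirectionalSigns qb v η μ := by
  have hadj : ∀ {J : α → E →L[ℝ] CSpace mI mE mC} {J₀ : E →L[ℝ] CSpace mI mE mC},
      Tendsto J 𝒰 (𝓝 J₀) → Tendsto (fun k => ContinuousLinearMap.adjoint (J k) (ηk k)) 𝒰
        (𝓝 (ContinuousLinearMap.adjoint J₀ η)) := fun h =>
    tendsto_clm_apply ((ContinuousLinearMap.adjoint.continuous.tendsto _).comp h) hη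
  have hgb : gb + ContinuousLinearMap.adjoint A η = 0 := by
    have h1 := (tendsto_of_tendsto_inv_smul ht ht0 hg).add
      (hadj (tendsto_of_tendsto_inv_smul ht ht0 hJ))
    have h2 : Tendsto (fun k => gk k + ContinuousLinearMap.adjoint (Jk k) (ηk k)) 𝒰 (𝓝 0) := by
      refine tendsto_of_tendsto_inv_smul ht ht0 (y₀ := 0) (v := 0) ?_
      simpa using hstat
    exact tendsto_nhds_unique h1 h2
  refine ⟨hgb, ?_⟩
  let S : (Fin mI ⊕ Fin mE ⊕ (Fin mC × Fin 2) → ℝ) →ₗ[ℝ] E :=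
    (ContinuousLinearMap.adjoint A : CSpace mI mE mC →L[ℝ] E).toLinearMap ∘ₗ
      (WithLp.linearEquiv 2 ℝ _).symm.toLinearMap
  have hS : ∀ y : CSpace mI mE mC, S y = ContinuousLinearMap.adjoint A y := fun y => rfl
  have hlim : Tendsto (fun k => S ((t k)⁻¹ • (ηk k - η) : CSpace mI mE mC)) 𝒰
      (𝓝 (-(hf + ContinuousLinearMap.adjoint Bu η))) := by
    have h1 := hstat.sub (hg.add (hadj hJ))
    rw [zero_sub] at h1
    refine h1.congr fun k => ?_
    have e1 : ContinuousLinearMap.adjoint ((t k)⁻¹ • (Jk k - A)) (ηk k) =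
        (t k)⁻¹ • (ContinuousLinearMap.adjoint (Jk k) (ηk k) -
          ContinuousLinearMap.adjoint A (ηk k)) := by
      rw [map_smulₛₗ, map_sub, conj_trivial, smul_apply, sub_apply]
    rw [hS, e1, map_smul, map_sub, ← smul_add, ← smul_sub, eq_neg_of_add_eq_zero_right hgb]
    congr 1
    abel
  obtain ⟨c, hc, hpos, hneg⟩ := exists_preimage_of_tendsto_of_signs S hlim
  have hηi := fun i => tendsto_coord hη i
  have hcz : ∀ i, (∀ᶠ k in (𝒰 : Filter α), ηk k i = 0) → η i = 0 ∧ c i = 0 := fun i hi => by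
    have h0 : η i = 0 := tendsto_nhds_unique ((hηi i).congr' hi) tendsto_const_nhds
    refine ⟨h0, le_antisymm (hneg i ?_) (hpos i ?_)⟩ <;>
    · filter_upwards [hi] with k hk
      simp [hk, h0]
  have hcn : ∀ i, (∀ᶠ k in (𝒰 : Filter α), 0 ≤ ηk k i) → 0 ≤ η i ∧ (η i = 0 → 0 ≤ c i) :=
    fun i hi => ⟨ge_of_tendsto (hηi i) hi, fun h0 => hpos i (by
      filter_upwards [hi, ht] with k hk hk'
      simpa [h0] using mul_nonneg (inv_nonneg.2 hk'.le) hk)⟩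
  refine ⟨WithLp.toLp 2 c, ?_, ⟨fun i hi => hcz i ?_, fun i => hcn _ (hN.mono fun k hk =>
    hk.nonneg i), fun j => ?_⟩⟩
  · have h1 : ContinuousLinearMap.adjoint A (WithLp.toLp 2 c) = S c := rfl
    rw [h1, hc, add_neg_cancel]
  · filter_upwards [hN, eventually_coord_ne_zero ht ht0 hQ hi] with k hk hk'
      using hk.eq_zero i hk'
  · have h3 := hN.mono fun k hk => hk.pair j
    rw [Ultrafilter.eventually_or, Ultrafilter.eventually_or] at h3
    rcases h3 with (h3 | h3) | h3
    · refine Or.inr fun k => ?_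
      fin_cases k
      · exact hcn _ (h3.mono fun k hk => hk.1)
      · exact hcn _ (h3.mono fun k hk => hk.2)
    · exact Or.inl ⟨0, hcz _ h3⟩
    · exact Or.inl ⟨1, hcz _ h3⟩

/-- Feasibility to second order yields a second-order tangent direction `ν` for the critical
direction `u`. As for the multipliers, the difference quotients `2 (x_k - x̄ - t_k u) / t_k²` may be
unbounded. -/
theorem exists_second_order_direction (ht : ∀ᶠ k in (𝒰 : Filter α), 0 < t k)
    (ht0 : Tendsto t 𝒰 (𝓝 0)) {xk : α → EuclideanSpace ℝ (Fin n)}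
    {xb u : EuclideanSpace ℝ (Fin n)} {A : EuclideanSpace ℝ (Fin n) →L[ℝ] CSpace mI mE mC}
    {w : CSpace mI mE mC}
    (hQ : Tendsto (fun k => (t k)⁻¹ • (Qk k - qb)) 𝒰 (𝓝 (A u)))
    (hQ2 : Tendsto (fun k => (t k ^ 2)⁻¹ • (Qk k - qb - A (xk k - xb))) 𝒰 (𝓝 ((2⁻¹ : ℝ) • w)))
    (hQP : ∀ᶠ k in (𝒰 : Filter α), Qk k ∈ mpecSet mI mE mC) :
    ∃ ν, (∀ i, qb (Sum.inl i) = 0 → (A ν + w) (Sum.inl i) ≤ 0) ∧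
      (∀ i, qb i = 0 → A u i = 0 → (A ν + w) i ≤ 0) ∧
      (∀ i, (∀ᶠ k in (𝒰 : Filter α), Qk k i = 0) → (A ν + w) i = 0) := by
  let ι := Fin mI ⊕ Fin mE ⊕ (Fin mC × Fin 2)
  let S : (Fin n ⊕ ι → ℝ) →ₗ[ℝ] CSpace mI mE mC :=
    A.toLinearMap ∘ₗ (WithLp.linearEquiv 2 ℝ _).symm.toLinearMap ∘ₗ LinearMap.funLeft ℝ ℝ Sum.inl -
      (WithLp.linearEquiv 2 ℝ _).symm.toLinearMap ∘ₗ LinearMap.funLeft ℝ ℝ Sum.inr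
  have hS : ∀ (x : EuclideanSpace ℝ (Fin n)) (y : CSpace mI mE mC),
      S (Sum.elim x y) = A x - y := fun x y => rfl
  let νk : α → EuclideanSpace ℝ (Fin n) := fun k => (2 * (t k ^ 2)⁻¹) • (xk k - xb - t k • u)
  let zk : α → CSpace mI mE mC := fun k => (2 * (t k ^ 2)⁻¹) • (Qk k - qb - t k • A u)
  have hlim : Tendsto (fun k => S (Sum.elim (νk k) (zk k))) 𝒰 (𝓝 (-w)) := by
    have h1 := hQ2.const_smul (-2 : ℝ)
    rw [smul_smul, show (-2 : ℝ) * 2⁻¹ = -1 by norm_num, neg_one_smul] at h1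
    refine h1.congr fun k => ?_
    rw [hS]
    simp only [νk, zk]
    simp only [map_sub, map_smul]
    module
  obtain ⟨c, hc, hpos, hneg⟩ := exists_preimage_of_tendsto_of_signs S hlim
  let ν₀ : EuclideanSpace ℝ (Fin n) := WithLp.toLp 2 fun i => c (Sum.inl i)
  have hθ : ∀ i, (A ν₀ + w) i = c (Sum.inr i) := fun i => by
    have h1 : S c = A ν₀ - (WithLp.toLp 2 fun i => c (Sum.inr i) : CSpace mI mE mC) := rfl
    have h2 : A ν₀ + w = (WithLp.toLp 2 fun i => c (Sum.inr i) : CSpace mI mE mC) := by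
      rw [hc] at h1
      rw [← neg_neg w, h1]
      abel
    rw [h2]
  have hle : ∀ i, qb i = 0 → A u i = 0 → c (Sum.inr i) ≤ 0 := fun i hq hu => hneg _ (by
    filter_upwards [hQP, ht] with k hk hk'
    have : 0 ≤ 2 * (t k ^ 2)⁻¹ := by positivity
    simpa [zk, hq, hu] using mul_nonpos_of_nonneg_of_nonpos this (nonpos_of_mem_mpecSet hk i))
  have heq : ∀ i, (∀ᶠ k in (𝒰 : Filter α), Qk k i = 0) → c (Sum.inr i) = 0 := fun i hi => by
    obtain ⟨hq, hu⟩ := coord_eq_zero_of_eventually ht ht0 hQ hi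
    refine le_antisymm (hle i hq hu) (hpos _ ?_)
    filter_upwards [hi] with k hk
    simp [zk, hq, hu, hk]
  have hu : ∀ i : Fin mI, qb (Sum.inl i) = 0 → A u (Sum.inl i) ≤ 0 := fun i hi => by
    refine le_of_tendsto (tendsto_coord hQ _) ?_
    filter_upwards [hQP, ht] with k hk hk'
    simpa [hi] using mul_nonpos_of_nonneg_of_nonpos (inv_nonneg.2 hk'.le) (hk.1 i)
  -- a large multiple of `u` repairs the inequalities that are strictly decreasing along `u`
  obtain ⟨s, hs⟩ := (eventually_all.2 fun i : Fin mI =>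
    eventually_ge_atTop (c (Sum.inr (Sum.inl i)) / -(A u (Sum.inl i)))).exists
  have hshift : ∀ i, (A (ν₀ + s • u) + w) i = c (Sum.inr i) + s * A u i := fun i => by
    rw [← hθ i]
    simp only [map_add, map_smul, PiLp.add_apply, PiLp.smul_apply, smul_eq_mul]
    ring
  refine ⟨ν₀ + s • u, fun i hi => ?_, fun i hq hu' => ?_, fun i hi => ?_⟩
  · rw [hshift]
    rcases (hu i hi).eq_or_lt with h | h
    · rw [h, mul_zero, add_zero]
      exact hle _ hi h
    · have := hs i
      rw [div_le_iff₀ (neg_pos.2 h)] at this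
      linarith
  · rw [hshift, hu', mul_zero, add_zero]
    exact hle i hq hu'
  · rw [hshift, heq i hi, (coord_eq_zero_of_eventually ht ht0 hQ hi).2, mul_zero, add_zero]

end Limits

/-! ### Limits of stationary points -/

section Limit

variable {E F G Ω : Type*} [NormedAddCommGroup E]

/-- If no local bound `‖x - x̄‖ ≤ L τ(ω)` holds, an ultrafilter converging to `(x̄, ω̄)` is
concentrated on points that violate it for `L → ∞`. -/
theorem exists_ultrafilter_of_not_subset_closedBall [TopologicalSpace Ω] {S : Ω → Set E}
    {τ : Ω → ℝ} {xb : E} {ob : Ω}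
    (h : ¬ ∃ U ∈ 𝓝 xb, ∃ W ∈ 𝓝 ob, ∃ L > (0 : ℝ), ∀ ω ∈ W,
      S ω ∩ U ⊆ Metric.closedBall xb (L * τ ω)) :
    ∃ 𝒰 : Ultrafilter ((E × Ω) × ℝ), Tendsto Prod.fst (𝒰 : Filter ((E × Ω) × ℝ)) (𝓝 (xb, ob)) ∧
      Tendsto Prod.snd (𝒰 : Filter ((E × Ω) × ℝ)) atTop ∧
      ∀ᶠ z in (𝒰 : Filter ((E × Ω) × ℝ)), z.1.1 ∈ S z.1.2 ∧ z.2 * τ z.1.2 < ‖z.1.1 - xb‖ := by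
  have hfreq : ∃ᶠ z in 𝓝 (xb, ob) ×ˢ (atTop : Filter ℝ),
      z.1.1 ∈ S z.1.2 ∧ z.2 * τ z.1.2 < ‖z.1.1 - xb‖ := by
    intro hev
    obtain ⟨pa, hpa, pb, hpb, hab⟩ := eventually_prod_iff.1 hev
    rw [nhds_prod_eq] at hpa
    obtain ⟨pU, hU, pW, hW, hUW⟩ := eventually_prod_iff.1 hpa
    obtain ⟨L, hL, hL0⟩ := (hpb.and (eventually_gt_atTop 0)).exists
    refine h ⟨_, hU, _, hW, L, hL0, fun ω hω x hx => ?_⟩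
    have h1 := hab (hUW hx.2 hω) hL
    simp only [not_and, not_lt] at h1
    rw [Metric.mem_closedBall, dist_eq_norm]
    exact h1 hx.1
  have := frequently_iff_neBot.1 hfreq
  refine ⟨Ultrafilter.of (𝓝 (xb, ob) ×ˢ atTop ⊓
    𝓟 {z | z.1.1 ∈ S z.1.2 ∧ z.2 * τ z.1.2 < ‖z.1.1 - xb‖}), ?_, ?_, ?_⟩
  · exact tendsto_fst.mono_left ((Ultrafilter.of_le _).trans inf_le_left)
  · exact tendsto_snd.mono_left ((Ultrafilter.of_le _).trans inf_le_left)
  · exact (Ultrafilter.of_le _).trans inf_le_right (mem_principal_self _)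

variable [InnerProductSpace ℝ E] [NormedAddCommGroup F] [InnerProductSpace ℝ F]
  {α : Type*} {l : Filter α} {x : α → E} {o : α → Ω} {xb u : E} {ob : Ω}

section Quotients

variable [NormedAddCommGroup G] [NormedSpace ℝ G] [TopologicalSpace Ω] {ψ : E → Ω → G}

theorem tendsto_difference_quotient (hlim : Tendsto (fun k => (x k, o k)) l (𝓝 (xb, ob)))
    (hu : Tendsto (fun k => ‖x k - xb‖⁻¹ • (x k - xb)) l (𝓝 u))
    (hd : ∀ᶠ p in 𝓝 (xb, ob), DifferentiableAt ℝ (fun y => ψ y p.2) p.1)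
    (hc : ContinuousAt (fun p : E × Ω => fderiv ℝ (fun y => ψ y p.2) p.1) (xb, ob))
    (h0 : Tendsto (fun k => ‖x k - xb‖⁻¹ • (ψ xb (o k) - ψ xb ob)) l (𝓝 0)) :
    Tendsto (fun k => ‖x k - xb‖⁻¹ • (ψ (x k) (o k) - ψ xb ob)) l
      (𝓝 (fderiv ℝ (fun y => ψ y ob) xb u)) := by
  have h1 := (((isLittleO_sub_sub_fderiv hd hc).comp_tendsto
    hlim).norm_right).tendsto_inv_smul_nhds_zero
  have h2 := (h1.add h0).add (((fderiv ℝ (fun y => ψ y ob) xb).continuous.tendsto u).comp hu)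
  rw [zero_add, zero_add] at h2
  refine h2.congr fun k => ?_
  simp only [Function.comp_apply, map_smul, ← smul_add]
  congr 1
  abel

/-- The second-order term survives with factor `1/2`, provided that the value and the derivative of
`ψ` at `x̄` depend on the parameter to the orders `o(t²)` and `o(t)`. -/
theorem tendsto_second_difference_quotient
    (hlim : Tendsto (fun k => (x k, o k)) l (𝓝 (xb, ob)))
    (hu : Tendsto (fun k => ‖x k - xb‖⁻¹ • (x k - xb)) l (𝓝 u))
    (hd : ∀ᶠ p in 𝓝 (xb, ob), DifferentiableAt ℝ (fun y => ψ y p.2) p.1)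
    (hd2 : ∀ᶠ p in 𝓝 (xb, ob),
      DifferentiableAt ℝ (fun y => fderiv ℝ (fun z => ψ z p.2) y) p.1)
    (hc2 : ContinuousAt
      (fun p : E × Ω => fderiv ℝ (fun y => fderiv ℝ (fun z => ψ z p.2) y) p.1) (xb, ob))
    (hsymm : ∀ v w, fderiv ℝ (fun y => fderiv ℝ (fun z => ψ z ob) y) xb v w =
      fderiv ℝ (fun y => fderiv ℝ (fun z => ψ z ob) y) xb w v)
    (h0 : Tendsto (fun k => (‖x k - xb‖ ^ 2)⁻¹ • (ψ xb (o k) - ψ xb ob)) l (𝓝 0))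
    (h1 : Tendsto (fun k => ‖x k - xb‖⁻¹ •
      (fderiv ℝ (fun y => ψ y (o k)) xb - fderiv ℝ (fun y => ψ y ob) xb)) l (𝓝 0)) :
    Tendsto (fun k => (‖x k - xb‖ ^ 2)⁻¹ •
      (ψ (x k) (o k) - ψ xb ob - fderiv ℝ (fun y => ψ y ob) xb (x k - xb))) l
      (𝓝 ((2⁻¹ : ℝ) • fderiv ℝ (fun y => fderiv ℝ (fun z => ψ z ob) y) xb u u)) := by
  have h2 := ((isLittleO_sub_sub_fderiv_sub_fderiv_fderiv hd hd2 hc2 hsymm).comp_tendsto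
    hlim).tendsto_inv_smul_nhds_zero
  have h3 := tendsto_clm_apply h1 hu
  have h4 := (tendsto_clm_apply
    (((fderiv ℝ (fun y => fderiv ℝ (fun z => ψ z ob) y) xb).continuous.tendsto u).comp hu)
    hu).const_smul (2⁻¹ : ℝ)
  have h5 := ((h2.add h0).add h3).add h4
  simp only [zero_apply, zero_add, add_zero] at h5
  refine h5.congr fun k => ?_
  simp only [Function.comp_apply, map_smul, smul_apply, sub_apply, ← inv_pow]
  module

end Quotients

/-- Near a point of metric regularity, every B- or M-stationary point is approximately stationary
with a limiting normal as multiplier, and this multiplier is controlled by the modulus. -/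
theorem exists_multiplier_of_stationary [FiniteDimensional ℝ E] [FiniteDimensional ℝ F]
    [CompleteSpace E] [CompleteSpace F] {f : E → Ω → ℝ} {q : E → Ω → F} {P : Set F}
    (hP : IsClosed P) {ω : Ω} {x : E} {κ : ℝ} (hκ : 0 < κ)
    (hreg : MetricallyRegularAround (constraintMap q P ω) κ x 0)
    (hq : ContDiffAt ℝ 2 (fun y => q y ω) x)
    (hx : x ∈ BStationary f q P ω ∪ MStationary f q P ω) {ε : ℝ} (hε : 0 < ε) :
    ∃ η ∈ limitingNormalCone P (q x ω),
      ‖η‖ ≤ 2 * κ * ‖ContinuousLinearMap.adjoint (jacX q x ω) η‖ ∧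
      ‖gradX f x ω + ContinuousLinearMap.adjoint (jacX q x ω) η‖ ≤ ε := by
  have hN := hreg.eventually_norm_le hκ (hq.differentiableAt (by norm_num)).hasFDerivAt
  rcases hx with ⟨ξ, hξ, h0⟩ | ⟨η, hη, h0⟩
  · obtain ⟨η, hη, hle⟩ := exists_limitingNormal_of_mem_regularNormalCone_preimage hP
      (q := fun y => q y ω) ((hq.eventually (by simp)).mono fun y hy =>
        hy.differentiableAt (by norm_num))
      (hq.fderiv_right (m := 1) (by norm_num)).continuousAt (by positivity) hN hξ hε
    refine ⟨η, hη, norm_le_of_mem_limitingNormalCone hN hη, ?_⟩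
    rw [eq_neg_of_add_eq_zero_left h0, neg_add_eq_sub, norm_sub_rev]
    exact hle
  · exact ⟨η, hη, norm_le_of_mem_limitingNormalCone hN hη, by rw [h0, norm_zero]; exact hε.le⟩

end Limit

namespace MPEC

variable {n mI mE mC : ℕ} {Ω : Type*} [TopologicalSpace Ω] {D : MPEC n mI mE mC Ω}
  {xb : EuclideanSpace ℝ (Fin n)} {ob : Ω} {u : EuclideanSpace ℝ (Fin n)}

/-- Translation of the vector conditions on `(λ, μ)` into the index-set conditions. -/
theorem lipschitzSystem_of_directionalSigns (hD : BasicAssumption D.f D.q xb ob)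
    {η μ : CSpace mI mE mC}
    (hgrad : gradX D.f xb ob + ContinuousLinearMap.adjoint (jacX D.q xb ob) η = 0)
    (hsecond : hessX D.f xb ob u + ContinuousLinearMap.adjoint (jac2X D.q xb ob u) η +
      ContinuousLinearMap.adjoint (jacX D.q xb ob) μ = 0)
    (hs : DirectionalSigns (D.q xb ob) (jacX D.q xb ob u) η μ) :
    D.LipschitzSystem xb ob u (Multiplier.ofVec η) (Multiplier.ofVec μ) := by
  obtain ⟨hfd, hqd⟩ := hD.eventually_contDiffAt.self_of_nhds
  have hg : ∀ i ∉ D.idxgDir xb ob u, η (Sum.inl i) = 0 ∧ μ (Sum.inl i) = 0 := fun i hi => by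
    refine hs.eq_zero _ ?_
    by_contra hne
    push Not at hne
    exact hi ⟨hne.1, by rw [inner_gradX_g hD]; exact hne.2⟩
  have hG : ∀ i ∈ D.idxPZ xb ob ∪ D.idxPZDir xb ob u,
      η (Sum.inr (Sum.inr (i, 0))) = 0 ∧ μ (Sum.inr (Sum.inr (i, 0))) = 0 := by
    rintro i (hi | hi) <;> refine hs.eq_zero _ ?_
    · exact Or.inl (by simpa [q] using hi.1.ne')
    · have := hi.2.1.ne'
      rw [inner_gradX_G hD] at this
      exact Or.inr (neg_ne_zero.1 this)
  have hH : ∀ i ∈ D.idxZP xb ob ∪ D.idxZPDir xb ob u,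
      η (Sum.inr (Sum.inr (i, 1))) = 0 ∧ μ (Sum.inr (Sum.inr (i, 1))) = 0 := by
    rintro i (hi | hi) <;> refine hs.eq_zero _ ?_
    · exact Or.inl (by simpa [q] using hi.2.ne')
    · have := hi.2.2.ne'
      rw [inner_gradX_H hD] at this
      exact Or.inr (neg_ne_zero.1 this)
  -- either one of the two multiplier pairs vanishes in both places, or both are nonnegative
  have hpair : ∀ i, (((Multiplier.ofVec η).G i = 0 ∧ (Multiplier.ofVec μ).G i = 0) ∨
      ((Multiplier.ofVec η).H i = 0 ∧ (Multiplier.ofVec μ).H i = 0)) ∨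
      (0 ≤ (Multiplier.ofVec η).G i ∧
        ((Multiplier.ofVec η).G i = 0 → 0 ≤ (Multiplier.ofVec μ).G i)) ∧
      0 ≤ (Multiplier.ofVec η).H i ∧
        ((Multiplier.ofVec η).H i = 0 → 0 ≤ (Multiplier.ofVec μ).H i) := fun i => by
    rcases hs.pair i with ⟨k, hk⟩ | h
    · fin_cases k
      · exact Or.inl (Or.inl hk)
      · exact Or.inl (Or.inr hk)
    · exact Or.inr ⟨h 0, h 1⟩
  refine ⟨⟨fun i _ => (hs.nonneg i).1, fun i hi => (hg i hi).1, fun i hi => (hH i hi).1,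
    fun i hi => (hG i hi).1, fun i _ => ?_⟩, ⟨fun i _ => (hs.nonneg i).2, fun i hi => (hg i hi).2,
    fun i hi => (hH i hi).2, fun i hi => (hG i hi).2, fun i _ h1 h2 => ?_, fun i _ h1 h2 => ?_,
    fun i _ h1 h2 => ?_, fun i _ h1 h2 => ?_, fun i _ h1 h2 => ?_⟩, ?_, ?_⟩
  · rcases hpair i with (h | h) | ⟨h, h'⟩
    · exact Or.inr (by rw [h.1, zero_mul])
    · exact Or.inr (by rw [h.1, mul_zero])
    · rcases h.1.eq_or_lt with h0 | h0
      · exact Or.inr (by rw [← h0, zero_mul])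
      · rcases h'.1.eq_or_lt with h0' | h0'
        · exact Or.inr (by rw [← h0', mul_zero])
        · exact Or.inl ⟨h0, h0'⟩
  · rcases hpair i with (h | h) | ⟨h, h'⟩
    · exact Or.inr (by rw [h.2, zero_mul])
    · exact Or.inr (by rw [h.2, mul_zero])
    · rcases (h.2 h1).eq_or_lt with h0 | h0
      · exact Or.inr (by rw [← h0, zero_mul])
      · rcases (h'.2 h2).eq_or_lt with h0' | h0'
        · exact Or.inr (by rw [← h0', mul_zero])
        · exact Or.inl ⟨h0, h0'⟩
  · rcases hpair i with (h | h) | ⟨h, h'⟩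
    · exact h.2.ge
    · exact absurd h.1 h2.ne'
    · exact h.2 h1
  · rcases hpair i with (h | h) | ⟨h, h'⟩
    · exact h.2
    · exact absurd h.1 h2.ne
    · exact absurd h'.1 h2.not_ge
  · rcases hpair i with (h | h) | ⟨h, h'⟩
    · exact absurd h.1 h2.ne'
    · exact h.2.ge
    · exact h'.2 h1
  · rcases hpair i with (h | h) | ⟨h, h'⟩
    · exact absurd h.1 h2.ne
    · exact h.2
    · exact absurd h.1 h2.not_ge
  · rw [gradX_eq_of_eq_add_inner (fun x => D.lagrangian_eq 1 _ x ob)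
      (hfd.differentiableAt (by norm_num)) (hqd.differentiableAt (by norm_num)),
      Multiplier.toVec_ofVec, one_smul, hgrad]
  · rw [gradX_eq_of_eq_add_inner (fun x => D.lagrangian_eq 0 _ x ob)
      (hfd.differentiableAt (by norm_num)) (hqd.differentiableAt (by norm_num)),
      hessX_eq_of_eq_add_inner (fun x => D.lagrangian_eq 1 _ x ob) hfd hqd,
      Multiplier.toVec_ofVec, Multiplier.toVec_ofVec, one_smul, zero_smul, zero_add, hsecond]

/-- A second-order direction `ν` that respects the activity of the constraints along the ultrafilter
solves the Hölder system; the scalar equation says that `λ` is orthogonal to `∇q ν + ∇²q(u, u)`. -/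
theorem hoelderSystem_of_eventually (hD : BasicAssumption D.f D.q xb ob) {α : Type*}
    {𝒰 : Ultrafilter α} {t : α → ℝ} {Qk ηk : α → CSpace mI mE mC} {η : CSpace mI mE mC}
    {ν : EuclideanSpace ℝ (Fin n)} (ht : ∀ᶠ k in (𝒰 : Filter α), 0 < t k)
    (ht0 : Tendsto t 𝒰 (𝓝 0))
    (hQ : Tendsto (fun k => (t k)⁻¹ • (Qk k - D.q xb ob)) 𝒰 (𝓝 (jacX D.q xb ob u)))
    (hQP : ∀ᶠ k in (𝒰 : Filter α), Qk k ∈ mpecSet mI mE mC)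
    (hη : Tendsto ηk 𝒰 (𝓝 η)) (hN : ∀ᶠ k in (𝒰 : Filter α), NormalSigns (Qk k) (ηk k))
    (hgrad : gradX D.f xb ob + ContinuousLinearMap.adjoint (jacX D.q xb ob) η = 0)
    (h1 : ∀ i, D.q xb ob (Sum.inl i) = 0 →
      (jacX D.q xb ob ν + jac2X D.q xb ob u u) (Sum.inl i) ≤ 0)
    (h2 : ∀ i, D.q xb ob i = 0 → jacX D.q xb ob u i = 0 →
      (jacX D.q xb ob ν + jac2X D.q xb ob u u) i ≤ 0)
    (h3 : ∀ i, (∀ᶠ k in (𝒰 : Filter α), Qk k i = 0) →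
      (jacX D.q xb ob ν + jac2X D.q xb ob u u) i = 0) :
    D.HoelderSystem xb ob u (Multiplier.ofVec η) ν := by
  obtain ⟨hfd, hqd⟩ := hD.eventually_contDiffAt.self_of_nhds
  have hor : ∀ j : Fin mC, ∀ᶠ k in (𝒰 : Filter α),
      Qk k (Sum.inr (Sum.inr (j, 0))) = 0 ∨ Qk k (Sum.inr (Sum.inr (j, 1))) = 0 := fun j =>
    hQP.mono fun k hk => eq_zero_or_eq_zero_of_mem_mpecSet hk j
  refine ⟨fun i hi => ?_, fun i => ?_, fun i hi => ?_, fun i hi => ?_, fun i hi => ?_, ?_⟩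
  · rw [secondOrderTerm_g hD]
    exact h1 i hi
  · rw [secondOrderTerm_h hD]
    exact h3 _ (hQP.mono fun k hk => hk.2.1 i)
  · have hne : ∀ᶠ k in (𝒰 : Filter α), Qk k (Sum.inr (Sum.inr (i, 1))) ≠ 0 := by
      refine eventually_coord_ne_zero ht ht0 hQ ?_
      rcases hi with hi | hi
      · exact Or.inl (by simpa [q] using hi.2.ne')
      · have := hi.2.2.ne'
        rw [inner_gradX_H hD] at this
        exact Or.inr (neg_ne_zero.1 this)
    rw [secondOrderTerm_G hD, h3, neg_zero]
    filter_upwards [hor i, hne] with k hk hk' using hk.resolve_right hk'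
  · have hne : ∀ᶠ k in (𝒰 : Filter α), Qk k (Sum.inr (Sum.inr (i, 0))) ≠ 0 := by
      refine eventually_coord_ne_zero ht ht0 hQ ?_
      rcases hi with hi | hi
      · exact Or.inl (by simpa [q] using hi.1.ne')
      · have := hi.2.1.ne'
        rw [inner_gradX_G hD] at this
        exact Or.inr (neg_ne_zero.1 this)
    rw [secondOrderTerm_H hD, h3, neg_zero]
    filter_upwards [hor i, hne] with k hk hk' using hk.resolve_left hk'
  · obtain ⟨⟨hG, hH⟩, hGu, hHu⟩ := hi
    rw [inner_gradX_G hD, neg_eq_zero] at hGu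
    rw [inner_gradX_H hD, neg_eq_zero] at hHu
    refine mem_contingentCone_QEC ⟨?_, ?_, ?_⟩
    · rw [secondOrderTerm_G hD]
      simpa using h2 _ (by simpa [q] using hG) hGu
    · rw [secondOrderTerm_H hD]
      simpa using h2 _ (by simpa [q] using hH) hHu
    · rw [secondOrderTerm_G hD, secondOrderTerm_H hD]
      simp only [Prod.neg_mk, neg_neg]
      rcases Ultrafilter.eventually_or.1 (hor i) with h | h
      · rw [h3 _ h, zero_mul]
      · rw [h3 _ h, mul_zero]
  · -- complementarity: where the multiplier does not vanish, the constraint is active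
    have hcompl : inner ℝ η (jacX D.q xb ob ν + jac2X D.q xb ob u u) = (0 : ℝ) := by
      rw [PiLp.inner_apply]
      refine Finset.sum_eq_zero fun i _ => ?_
      by_cases hi : η i = 0
      · simp [hi]
      · rw [h3 i, inner_zero_right]
        filter_upwards [hN, (tendsto_coord hη i).eventually_ne hi] with k hk hk'
        by_contra hne
        exact hk' (hk.eq_zero i hne)
    rw [hessX_eq_of_eq_add_inner (fun x => D.lagrangian_eq 0 _ x ob) hfd hqd,
      Multiplier.toVec_ofVec, zero_smul, zero_add, ContinuousLinearMap.adjoint_inner_right,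
      eq_neg_of_add_eq_zero_left hgrad, inner_neg_left, ContinuousLinearMap.adjoint_inner_left]
    rw [inner_add_right] at hcompl
    rw [real_inner_comm]
    linarith

/-- If the stationary points are not bounded by `L τ_l(ω)`, the normalized displacements of a
violating ultrafilter converge to a direction that solves the critical system. -/
theorem exists_critical_direction (hD : BasicAssumption D.f D.q xb ob)
    (hxb : xb ∈ feasibleSet D.q (mpecSet mI mE mC) ob) {l : ℕ} (hl : l = 1 ∨ l = 2)
    (hR : PropertyR D.q (mpecSet mI mE mC) xb ob l)
    (hneg : ¬ ∃ U ∈ 𝓝 xb, ∃ W ∈ 𝓝 ob, ∃ L > (0 : ℝ), ∀ ω ∈ W,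
      (BStationary D.f D.q (mpecSet mI mE mC) ω ∪ MStationary D.f D.q (mpecSet mI mE mC) ω) ∩ U ⊆
        Metric.closedBall xb (L * tauFun D.f D.q xb ob l ω)) :
    ∃ (u : EuclideanSpace ℝ (Fin n)) (lam mu : Multiplier mI mE mC), u ≠ 0 ∧
      u ∈ linearizedCone D.q (mpecSet mI mE mC) ob xb ∧ D.LipschitzSystem xb ob u lam mu ∧
      (l = 2 → ∃ ν, D.HoelderSystem xb ob u lam ν) := by
  obtain ⟨𝒰, hlim, hL, hz⟩ := exists_ultrafilter_of_not_subset_closedBall hneg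
  obtain ⟨U, hU, W, hW, κ, hκ, γ, hγ, hreg⟩ := hR
  let x : (EuclideanSpace ℝ (Fin n) × Ω) × ℝ → EuclideanSpace ℝ (Fin n) := fun z => z.1.1
  let o : (EuclideanSpace ℝ (Fin n) × Ω) × ℝ → Ω := fun z => z.1.2
  let t : (EuclideanSpace ℝ (Fin n) × Ω) × ℝ → ℝ := fun z => ‖x z - xb‖
  let τ := tauFun D.f D.q xb ob l
  have hlim' : Tendsto (fun z => (x z, o z)) 𝒰 (𝓝 (xb, ob)) := hlim
  have hx : Tendsto x 𝒰 (𝓝 xb) := (continuous_fst.tendsto _).comp hlim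
  have ho : Tendsto o 𝒰 (𝓝 ob) := (continuous_snd.tendsto _).comp hlim
  have he0 : ∀ ω, 0 ≤ eFun D.q xb ob l ω := fun ω => by unfold eFun; positivity
  have heτ : ∀ ω, eFun D.q xb ob l ω ≤ τ ω := fun ω => le_add_of_nonneg_left (norm_nonneg _)
  have hτ0 : ∀ ω, 0 ≤ τ ω := fun ω => (he0 ω).trans (heτ ω)
  have ht : ∀ᶠ z in (𝒰 : Filter _), 0 < t z := by
    filter_upwards [hz, hL.eventually (eventually_gt_atTop 0)] with z h1 h2
    exact (mul_nonneg h2.le (hτ0 _)).trans_lt h1.2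
  have ht0 : Tendsto t 𝒰 (𝓝 0) := by
    simpa using (hx.sub_const xb).norm
  have hτt : Tendsto (fun z => (t z)⁻¹ * τ (o z)) 𝒰 (𝓝 0) := by
    refine squeeze_zero' (Eventually.of_forall fun z => mul_nonneg
      (inv_nonneg.2 (norm_nonneg _)) (hτ0 _)) ?_ (tendsto_inv_atTop_zero.comp hL)
    filter_upwards [hz, ht, hL.eventually (eventually_gt_atTop 0)] with z h1 h2 h3
    rw [Function.comp_apply, inv_mul_le_iff₀ h2, ← div_eq_mul_inv, le_div_iff₀ h3, mul_comm]
    exact h1.2.le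
  have hsmall : ∀ {V : Type} [NormedAddCommGroup V] [NormedSpace ℝ V] {r : Ω → V},
      (∀ ω, ‖r ω‖ ≤ τ ω) → Tendsto (fun z => (t z)⁻¹ • r (o z)) 𝒰 (𝓝 0) := fun {V} _ _ r hr => by
    refine squeeze_zero_norm (fun z => ?_) hτt
    rw [norm_smul, norm_inv, Real.norm_of_nonneg (norm_nonneg _)]
    exact mul_le_mul_of_nonneg_left (hr _) (inv_nonneg.2 (norm_nonneg _))
  have hg0 := hsmall (r := fun ω => gradX D.f xb ω - gradX D.f xb ob)
    fun ω => le_add_of_nonneg_right (he0 ω)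
  have hJ0 := hsmall (r := fun ω => jacX D.q xb ω - jacX D.q xb ob)
    fun ω => (le_add_of_nonneg_right (by positivity)).trans (heτ ω)
  have hroot : ∀ ω, ‖D.q xb ω - D.q xb ob‖ ^ (1 / (l : ℝ)) ≤ τ ω := fun ω =>
    (le_add_of_nonneg_left (norm_nonneg _)).trans (heτ ω)
  have hq2 : l = 2 → Tendsto (fun z => (t z ^ 2)⁻¹ • (D.q xb (o z) - D.q xb ob)) 𝒰 (𝓝 0) := by
    intro h2
    have h3 := hτt.pow 2
    rw [zero_pow two_ne_zero] at h3
    refine squeeze_zero_norm (fun z => ?_) h3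
    rw [norm_smul, norm_inv, Real.norm_of_nonneg (sq_nonneg _), mul_pow, inv_pow]
    refine mul_le_mul_of_nonneg_left ?_ (inv_nonneg.2 (sq_nonneg _))
    have h4 := hroot (o z)
    rw [h2, Nat.cast_ofNat, ← Real.sqrt_eq_rpow] at h4
    exact (Real.sqrt_le_left (hτ0 _)).1 h4
  have hq1 : Tendsto (fun z => (t z)⁻¹ • (D.q xb (o z) - D.q xb ob)) 𝒰 (𝓝 0) := by
    rcases hl with rfl | h2
    · refine hsmall (r := fun ω => D.q xb ω - D.q xb ob) fun ω => ?_
      simpa using hroot ω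
    · have h3 := ht0.smul (hq2 h2)
      rw [smul_zero] at h3
      refine h3.congr' ?_
      filter_upwards [ht] with z hz'
      rw [smul_smul]
      congr 1
      field_simp
  obtain ⟨u, hu1, hu⟩ : ∃ u ∈ Metric.sphere (0 : EuclideanSpace ℝ (Fin n)) 1,
      Tendsto (fun z => ‖x z - xb‖⁻¹ • (x z - xb)) 𝒰 (𝓝 u) :=
    isCompact_iff_ultrafilter_le_nhds'.1 (isCompact_sphere _ _)
      (𝒰.map fun z => ‖x z - xb‖⁻¹ • (x z - xb)) (Ultrafilter.mem_map.2 (by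
        filter_upwards [ht] with z hz'
        have : ‖x z - xb‖ ≠ 0 := hz'.ne'
        simp [norm_smul, this]))
  have hu0 : u ≠ 0 := by
    rintro rfl
    simp at hu1
  have hCD := hD.eventually_contDiffAt
  have hg := tendsto_difference_quotient (ψ := gradX D.f) hlim' hu
    (hCD.mono fun p hp => differentiableAt_gradX hp.1) hD.continuousAt_hessX hg0
  have hJ := tendsto_difference_quotient (ψ := jacX D.q) hlim' hu
    (hCD.mono fun p hp => differentiableAt_jacX hp.2) hD.continuousAt_jac2X hJ0
  have hQ := tendsto_difference_quotient (ψ := D.q) hlim' hu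
    (hCD.mono fun p hp => hp.2.differentiableAt (by norm_num)) hD.continuousAt_jacX hq1
  have hfeas : ∀ᶠ z in (𝒰 : Filter _), D.q (x z) (o z) ∈ mpecSet mI mE mC := by
    filter_upwards [hz] with z h1
    rcases h1.1 with ⟨ξ, hξ, -⟩ | ⟨η, hη, -⟩
    · exact hξ.1
    · exact hη.1
  have hmult : ∀ᶠ z in (𝒰 : Filter _), ∃ η ∈ limitingNormalCone (mpecSet mI mE mC)
      (D.q (x z) (o z)),
      ‖η‖ ≤ 2 * κ * ‖ContinuousLinearMap.adjoint (jacX D.q (x z) (o z)) η‖ ∧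
      ‖gradX D.f (x z) (o z) + ContinuousLinearMap.adjoint (jacX D.q (x z) (o z)) η‖ ≤
        t z ^ 2 := by
    filter_upwards [hz, ht, hfeas, hlim.eventually hCD, hx.eventually hU, ho.eventually hW,
      hL.eventually (eventually_ge_atTop γ)] with z h1 h2 h3 h4 h5 h6 h7
    refine exists_multiplier_of_stationary isClosed_mpecSet hκ
      (hreg _ h6 _ ⟨h3, h5⟩ ?_) h4.2 h1.1 (by positivity)
    calc γ * eFun D.q xb ob l (o z) ≤ z.2 * τ (o z) :=
          mul_le_mul h7 (heτ _) (he0 _) (hγ.le.trans h7)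
      _ < _ := h1.2
  obtain ⟨ηk, hηk⟩ := hmult.choice
  have hgk := tendsto_of_tendsto_inv_smul ht ht0 hg
  obtain ⟨η, -, hη⟩ : ∃ η ∈ Metric.closedBall (0 : CSpace mI mE mC)
      (2 * κ * (‖gradX D.f xb ob‖ + 1 + 1)), Tendsto ηk 𝒰 (𝓝 η) := by
    refine isCompact_iff_ultrafilter_le_nhds'.1 (isCompact_closedBall _ _) (𝒰.map ηk)
      (Ultrafilter.mem_map.2 ?_)
    filter_upwards [hηk, hgk.norm.eventually (gt_mem_nhds (lt_add_one _)),
      ht0.eventually (gt_mem_nhds one_pos), ht] with z h1 h2 h3 h4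
    rw [Set.mem_preimage, mem_closedBall_zero_iff]
    refine h1.2.1.trans ?_
    gcongr
    have h5 : ContinuousLinearMap.adjoint (jacX D.q (x z) (o z)) (ηk z) =
      (gradX D.f (x z) (o z) + ContinuousLinearMap.adjoint (jacX D.q (x z) (o z)) (ηk z)) -
        gradX D.f (x z) (o z) := by abel
    rw [h5]
    have h6 : t z ^ 2 ≤ 1 := pow_le_one₀ h4.le h3.le
    have h7 := norm_sub_le (gradX D.f (x z) (o z) +
      ContinuousLinearMap.adjoint (jacX D.q (x z) (o z)) (ηk z)) (gradX D.f (x z) (o z))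
    linarith [h1.2.2]
  have hN : ∀ᶠ z in (𝒰 : Filter _), NormalSigns (D.q (x z) (o z)) (ηk z) :=
    hηk.mono fun z h => normalSigns_of_mem_limitingNormalCone h.1
  have hstat : Tendsto (fun z => (t z)⁻¹ • (gradX D.f (x z) (o z) +
      ContinuousLinearMap.adjoint (jacX D.q (x z) (o z)) (ηk z))) 𝒰 (𝓝 0) := by
    refine squeeze_zero_norm' ?_ ht0
    filter_upwards [hηk, ht] with z h1 h2
    rw [norm_smul, norm_inv, Real.norm_of_nonneg h2.le, inv_mul_le_iff₀ h2, ← sq]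
    exact h1.2.2
  obtain ⟨hgrad, μ, hsecond, hsigns⟩ := exists_tangent_multiplier ht ht0 hg hJ hQ hη hN hstat
  refine ⟨u, Multiplier.ofVec η, Multiplier.ofVec μ, hu0,
    mem_contingentCone_of_tendsto hxb ht ht0 hQ hfeas,
    lipschitzSystem_of_directionalSigns hD hgrad hsecond hsigns, fun h2 => ?_⟩
  have hsymm := (hCD.self_of_nhds.2.isSymmSndFDerivAt (by simp))
  have hQ2 := tendsto_second_difference_quotient (ψ := D.q) hlim' hu
    (hCD.mono fun p hp => hp.2.differentiableAt (by norm_num))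
    (hCD.mono fun p hp => differentiableAt_jacX hp.2) hD.continuousAt_jac2X hsymm (hq2 h2) hJ0
  obtain ⟨ν, h1, h2, h3⟩ := exists_second_order_direction ht ht0 hQ hQ2 hfeas
  exact ⟨ν, hoelderSystem_of_eventually hD ht ht0 hQ hfeas hη hN hgrad h1 h2 h3⟩

end MPEC

end ParamMPEC

end

theorem mainTheorem7 {n mI mE mC : ℕ} {Ω : Type*} [TopologicalSpace Ω]
    (D : ParamMPEC.MPEC n mI mE mC Ω) (xb : EuclideanSpace ℝ (Fin n)) (ob : Ω)
    (hD : ParamMPEC.BasicAssumption D.f D.q xb ob)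
    (hxb : xb ∈ ParamMPEC.feasibleSet D.q (ParamMPEC.mpecSet mI mE mC) ob) :
    (ParamMPEC.PropertyR D.q (ParamMPEC.mpecSet mI mE mC) xb ob 1 →
      (¬ ∃ (u : EuclideanSpace ℝ (Fin n)) (lam mu : ParamMPEC.Multiplier mI mE mC),
        u ≠ 0 ∧ u ∈ ParamMPEC.linearizedCone D.q (ParamMPEC.mpecSet mI mE mC) ob xb ∧
        D.LipschitzSystem xb ob u lam mu) →
      ∃ U ∈ 𝓝 xb, ∃ W ∈ 𝓝 ob, ∃ L > (0 : ℝ), ∀ ω ∈ W,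
        (ParamMPEC.BStationary D.f D.q (ParamMPEC.mpecSet mI mE mC) ω ∪
          ParamMPEC.MStationary D.f D.q (ParamMPEC.mpecSet mI mE mC) ω) ∩ U ⊆
          Metric.closedBall xb (L * ParamMPEC.tauFun D.f D.q xb ob 1 ω)) ∧
    (ParamMPEC.PropertyR D.q (ParamMPEC.mpecSet mI mE mC) xb ob 2 →
      (¬ ∃ (u : EuclideanSpace ℝ (Fin n)) (lam mu : ParamMPEC.Multiplier mI mE mC)
          (ν : EuclideanSpace ℝ (Fin n)),
        u ≠ 0 ∧ u ∈ ParamMPEC.linearizedCone D.q (ParamMPEC.mpecSet mI mE mC) ob xb ∧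
        D.LipschitzSystem xb ob u lam mu ∧ D.HoelderSystem xb ob u lam ν) →
      ∃ U ∈ 𝓝 xb, ∃ W ∈ 𝓝 ob, ∃ L > (0 : ℝ), ∀ ω ∈ W,
        (ParamMPEC.BStationary D.f D.q (ParamMPEC.mpecSet mI mE mC) ω ∪
          ParamMPEC.MStationary D.f D.q (ParamMPEC.mpecSet mI mE mC) ω) ∩ U ⊆
          Metric.closedBall xb (L * ParamMPEC.tauFun D.f D.q xb ob 2 ω)) := by
  refine ⟨fun hR hno => ?_, fun hR hno => ?_⟩ <;> by_contra hneg
  · obtain ⟨u, lam, mu, hu, hlin, hsys, -⟩ :=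
      ParamMPEC.MPEC.exists_critical_direction hD hxb (Or.inl rfl) hR hneg
    exact hno ⟨u, lam, mu, hu, hlin, hsys⟩
  · obtain ⟨u, lam, mu, hu, hlin, hsys, hν⟩ :=
      ParamMPEC.MPEC.exists_critical_direction hD hxb (Or.inr rfl) hR hneg
    obtain ⟨ν, hν⟩ := hν rfl
    exact hno ⟨u, lam, mu, ν, hu, hlin, hsys, hν⟩
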